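/- Let $F(x)=\frac1N\sum_{i=1}^N f_i(x)$ on $\mathbb R^d$ ($d,N\ge 1$), where $F$ is bounded below and every $f_i$ is twice continuously differentiable with $f_i$, $\nabla f_i$ and $\nabla^2 f_i$ Lipschitz with constants $L_0$, $L_1$ and $L_2$ (Euclidean and spectral norms). Consider the stochastic variance-reduced cubic-regularized Newton method (SVRC) started at $x_0$, with epoch length $m$ and threshold $\epsilon_1$. In iteration $k=0,1,\dots$: if $m\mid k$, put $\tilde x=x_k$, $g_k=\nabla F(x_k)$, $H_k=\nabla^2F(x_k)$ (this uses $|\xi_H(k)|:=N$ Hessian samples); otherwise draw index sets $\xi_g(k),\xi_H(k)$ uniformly at random among the subsets of $\{1,\dots,N\}$ of prescribed cardinalities (sampling without replacement) and put $$g_k=\frac1{|\xi_g(k)|}\sum_{i\in\xi_g(k)}\big(\nabla f_i(x_k)-\nabla f_i(\tilde x)\big)+\nabla F(\tilde x),\qquad H_k=\frac1{|\xi_H(k)|}\sum_{i\in\xi_H(k)}\big(\nabla^2 f_i(x_k)-\nabla^2 f_i(\tilde x)\big)+\nabla^2F(\tilde x).$$ Then let $s_{k+1}$ be a global minimizer of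 $s\mapsto g_k^\top s+\frac12 s^\top H_ks+\frac M6\|s\|^3$ (selected by an arbitrary fixed oracle, a function of $(g_k,H_k)$), put $x_{k+1}=x_k+s_{k+1}$, and stop with output $x_{k+1}$ if $\max\{\|s_{k+1}\|,\|s_k\|\}\le\epsilon_1$, with the convention $\|s_0\|=\epsilon_1$. The cardinalities are the smallest positive integers with $$|\xi_g(k)|\ge\Big(\tfrac1N+\tfrac{\beta^2\max\{\|s_k\|^4,\epsilon_1^4\}}{64L_1^2\|x_k-\tilde x\|^2\log(2(d+1)/\zeta)}\Big)^{-1},\qquad |\xi_H(k)|\ge\Big(\tfrac1N+\tfrac{\alpha^2\max\{\|s_k\|^2,\epsilon_1^2\}}{64L_2^2\|x_k-\tilde x\|^2\log(4d/\zeta)}\Big)^{-1}$$ (a right-hand side is read as $0$ if a denominator $64L_j^2\|x_k-\tilde x\|^2\log(\cdot)$ vanishes). Let $M\in\mathbb R$ and $\alpha,\beta>0$ satisfy $\gamma:=\frac{3M-2L_2}{24}-\frac52\beta-\frac54\alpha>0$, let $\Delta\ge F(x_0)-\inf F$, and for $0<\epsilon\le1$ and $0<\delta<1$ take $\epsilon_1=\tau\sqrt\epsilon$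 with $\tau=\min\{(\frac{L_2+M}2+2\beta+2\alpha)^{-1/2},(\frac{M+2L_2}2+2\alpha)^{-1}\}$, $m=\lceil N^{1/3}\rceil$ and $\zeta=\delta/(2K)$ with $K=\big\lfloor\frac{\Delta+(2\beta+\alpha)\epsilon_1^3}{\gamma\epsilon_1^3}\big\rfloor+1$. Then there is a constant $C>0$, depending only on $L_0,L_1,L_2,M,\alpha,\beta,\Delta$ (not on $d,N,f_1,\dots,f_N,x_0,\epsilon,\delta$ or the oracle), such that with probability at least $1-\delta$ the algorithm stops, after a number of iterations bounded by a deterministic finite number, at some iteration $k$; its output $x_{k+1}$ is an $\epsilon$-approximate second-order stationary point, that is, $\|\nabla F(x_{k+1})\|\le\epsilon$ and $\nabla^2F(x_{k+1})\succeq-\sqrt\epsilon\,I$; and the total number of Hessian samples satisfies $$\sum_{i=0}^{k}|\xi_H(i)|\le N+\frac{C\,N^{2/3}}{\epsilon^{3/2}}\log\Big(\frac{8d}{\epsilon\delta}\Big),$$ where the term $N$ is the full Hessian at $x_0$; if moreover $N^{1/3}\le\epsilon^{-3/2}$, then $$\sum_{i=0}^{k}|\xi_H(i)|\le\frac{C\,N^{2/3}}{\epsilon^{3/2}}\log\Big(\frac{8d}{\epsilon\delta}\Big).$$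 -/

import Mathlib

open scoped NNReal ENNReal

noncomputable section

namespace SVRC

/-- The space `ℝ^d` with the Euclidean norm. -/
abbrev E (d : ℕ) : Type := EuclideanSpace ℝ (Fin d)

/-- The Hessian of `f` at `x`, as a linear operator; its norm is the spectral norm. -/
def hess {d : ℕ} (f : E d → ℝ) (x : E d) : E d →L[ℝ] E d := fderiv ℝ (gradient f) x

/-- The finite-sum objective `F = (1/N) ∑ f_i`. -/
def objective {d N : ℕ} (f : Fin N → E d → ℝ) (x : E d) : ℝ := (1 / (N : ℝ)) * ∑ i, f i x

/-- Standing assumptions: `F` is bounded below, and all `f_i`, `∇ f_i`, `∇² f_i` are Lipschitz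
with constants `L₀`, `L₁`, `L₂`. -/
structure StandingAssumption {d N : ℕ} (f : Fin N → E d → ℝ) (L₀ L₁ L₂ : ℝ≥0) : Prop where
  bddBelow : BddBelow (Set.range (objective f))
  contDiff : ∀ i, ContDiff ℝ 2 (f i)
  lipschitz_value : ∀ i, LipschitzWith L₀ (f i)
  lipschitz_gradient : ∀ i, LipschitzWith L₁ (gradient (f i))
  lipschitz_hess : ∀ i, LipschitzWith L₂ (hess (f i))

/-- `ε`-approximate second-order stationary points: `‖∇F(x)‖ ≤ ε` and `∇²F(x) ≽ -√ε I`. -/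
def IsApproxSOSP {d : ℕ} (F : E d → ℝ) (ε : ℝ) (x : E d) : Prop :=
  ‖gradient F x‖ ≤ ε ∧ ∀ v : E d, -Real.sqrt ε * ‖v‖ ^ 2 ≤ inner ℝ v (hess F x v)

/-- The cubic-regularized model `gᵀ s + (1/2) sᵀ H s + (M/6) ‖s‖³`. -/
def cubicModel {d : ℕ} (M : ℝ) (g : E d) (H : E d →L[ℝ] E d) (s : E d) : ℝ :=
  inner ℝ g s + 1 / 2 * inner ℝ s (H s) + M / 6 * ‖s‖ ^ 3

/-- `solve` is a subproblem oracle: for a vector `g` and a symmetric `H` it returns a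
global minimizer of the cubic model (any one of them, if there are several). -/
def IsCubicSolver {d : ℕ} (M : ℝ) (solve : E d → (E d →L[ℝ] E d) → E d) : Prop :=
  ∀ (g : E d) (H : E d →L[ℝ] E d), (∀ u v, inner ℝ (H u) v = inner ℝ u (H v)) →
    ∀ s, cubicModel M g H (solve g H) ≤ cubicModel M g H s

/-- Parameters of the algorithm: cubic penalty `M`, threshold `ε₁`, epoch length `m`, and the
quantities `L₁, L₂, α, β, ζ` which determine the mini-batch sizes. -/
structure Params where
  L₁ : ℝ
  L₂ : ℝ
  M : ℝ
  α : ℝ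
  β : ℝ
  ε₁ : ℝ
  ζ : ℝ
  m : ℕ

/-- The smallest positive integer `n` with `n ≥ (1/N + a/b)⁻¹`, where `a > 0` and `b ≥ 0`.
The right-hand side is written as `N b / (b + N a)`, which also gives it the value `0` that it
has in the limit `b → 0`. This number is at most `N`. -/
def batchSize (N : ℕ) (a b : ℝ) : ℕ := max 1 ⌈(N * b) / (b + N * a)⌉₊

/-- Mini-batch size for gradients at the iterate `x`, when the current epoch started at `xref`
and the last step had norm `r`. -/
def gradBatch (p : Params) {d : ℕ} (N : ℕ) (x xref : E d) (r : ℝ) : ℕ :=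
  batchSize N (p.β ^ 2 * max (r ^ 4) (p.ε₁ ^ 4))
    (64 * p.L₁ ^ 2 * ‖x - xref‖ ^ 2 * Real.log (2 * ((d : ℝ) + 1) / p.ζ))

/-- Mini-batch size for Hessians. -/
def hessBatch (p : Params) {d : ℕ} (N : ℕ) (x xref : E d) (r : ℝ) : ℕ :=
  batchSize N (p.α ^ 2 * max (r ^ 2) (p.ε₁ ^ 2))
    (64 * p.L₂ ^ 2 * ‖x - xref‖ ^ 2 * Real.log (4 * (d : ℝ) / p.ζ))

/-- Sampling without replacement: a uniformly random subset of `{1, …, N}` of cardinality `n`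
(truncated at `N`, so that the law exists for every `n`). -/
def sampleSubset (N n : ℕ) : PMF (Finset (Fin N)) :=
  PMF.uniformOfFinset (Finset.powersetCard (min n N) Finset.univ)
    (Finset.powersetCard_nonempty.2 (by simp))

/-- The variance-reduced gradient estimator. -/
def gradEst {d N : ℕ} (f : Fin N → E d → ℝ) (x xref : E d) (ξ : Finset (Fin N)) : E d :=
  (1 / (ξ.card : ℝ)) • ∑ i ∈ ξ, (gradient (f i) x - gradient (f i) xref)
    + gradient (objective f) xref

/-- The variance-reduced Hessian estimator. -/
def hessEst {d N : ℕ} (f : Fin N → E d → ℝ) (x xref : E d) (ξ : Finset (Fin N)) :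
    E d →L[ℝ] E d :=
  (1 / (ξ.card : ℝ)) • ∑ i ∈ ξ, (hess (f i) x - hess (f i) xref)
    + hess (objective f) xref

/-- State of the algorithm. While it runs: the iterate `x_k`, the starting point of the current
epoch, the norm `‖s_k‖` of the last step, and the number of Hessian samples used so far.
After termination: the output and the total number of Hessian samples. -/
inductive State (d : ℕ) : Type where
  | running (x xref : E d) (r : ℝ) (cost : ℕ) : State d
  | done (output : E d) (cost : ℕ) : State d

open Classical in
/-- The step `x_{k+1} = x_k + s_{k+1}` with `s_{k+1}` a minimizer of the cubic model, followed by
the termination test `max {‖s_{k+1}‖, ‖s_k‖} ≤ ε₁`. -/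
def advance (p : Params) {d : ℕ} (solve : E d → (E d →L[ℝ] E d) → E d)
    (x xref : E d) (r : ℝ) (cost : ℕ) (g : E d) (H : E d →L[ℝ] E d) : State d :=
  if max ‖solve g H‖ r ≤ p.ε₁ then State.done (x + solve g H) cost
  else State.running (x + solve g H) xref ‖solve g H‖ cost

/-- Iteration `k` of the algorithm. If `m ∣ k`, the full gradient and Hessian are used (`N`
Hessian samples) and a new epoch starts; otherwise the index sets are drawn without
replacement, and `|ξ_H(k)|` Hessian samples are used. -/
def iteration (p : Params) {d N : ℕ} (f : Fin N → E d → ℝ)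
    (solve : E d → (E d →L[ℝ] E d) → E d) (k : ℕ) : State d → PMF (State d)
  | State.done y c => PMF.pure (State.done y c)
  | State.running x xref r c =>
      if k % p.m = 0 then
        PMF.pure (advance p solve x x r (c + N) (gradient (objective f) x) (hess (objective f) x))
      else
        (sampleSubset N (gradBatch p N x xref r)).bind fun ξg =>
          (sampleSubset N (hessBatch p N x xref r)).bind fun ξH =>
            PMF.pure (advance p solve x xref r (c + ξH.card)
              (gradEst f x xref ξg) (hessEst f x xref ξH))

/-- Law of the state of SVRC, started at `x₀` with the convention `‖s_0‖ = ε₁`, after the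
iterations `0, …, n - 1`. -/
def run (p : Params) {d N : ℕ} (f : Fin N → E d → ℝ)
    (solve : E d → (E d →L[ℝ] E d) → E d) (x₀ : E d) : ℕ → PMF (State d)
  | 0 => PMF.pure (State.running x₀ x₀ p.ε₁ 0)
  | n + 1 => (run p f solve x₀ n).bind (iteration p f solve n)

/-- The constant `γ = (3M - 2L₂)/24 - (5/2)β - (5/4)α`. -/
def gammaConst (L₂ M α β : ℝ) : ℝ := (3 * M - 2 * L₂) / 24 - 5 / 2 * β - 5 / 4 * α

/-- The constant `τ = min {((L₂+M)/2 + 2β + 2α)^(-1/2), ((M+2L₂)/2 + 2α)^(-1)}`. -/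
def tauConst (L₂ M α β : ℝ) : ℝ :=
  min (((L₂ + M) / 2 + 2 * β + 2 * α) ^ (-(1 / 2) : ℝ)) ((M + 2 * L₂) / 2 + 2 * α)⁻¹

/-- The bound `⌊(Δ + (2β+α)ε₁³) / (γ ε₁³)⌋ + 1` on the number of iterations, where `Δ` bounds
`F(x₀) - inf F`. -/
def iterBound (L₂ M α β Δ ε₁ : ℝ) : ℕ :=
  ⌊(Δ + (2 * β + α) * ε₁ ^ 3) / (gammaConst L₂ M α β * ε₁ ^ 3)⌋₊ + 1

/-- The choice of parameters for accuracy `ε` and confidence `1 - δ`: `ε₁ = τ √ε`,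
`ζ = δ / (2K)` with `K` the iteration bound, and `m = ⌈N^(1/3)⌉`. -/
def paramsFor (L₁ L₂ M α β Δ : ℝ) (N : ℕ) (ε δ : ℝ) : Params where
  L₁ := L₁
  L₂ := L₂
  M := M
  α := α
  β := β
  ε₁ := tauConst L₂ M α β * Real.sqrt ε
  ζ := δ / (2 * (iterBound L₂ M α β Δ (tauConst L₂ M α β * Real.sqrt ε) : ℝ))
  m := ⌈(N : ℝ) ^ (1 / 3 : ℝ)⌉₊

end SVRC

end

/-! The proof separates a deterministic analysis of iterations with accurate estimators from a union
bound over inaccurate ones. Write `R = max ‖s_k‖ ε₁`, and call iteration `k` good if the gradient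
error is at most `β R²` and the Hessian error at most `α R`.

Deterministic part. A global minimizer of the cubic model satisfies a stationarity equation and `H +
(M/2)‖s‖ I ≽ 0`. With Taylor's formula this makes a good step decrease `F` by a multiple of `‖s‖³`,
up to errors in `R³`. As long as the algorithm does not stop, two consecutive steps satisfy `ε₁³ ≤
‖s_{k+1}‖³ + ‖s_k‖³`, so `R³` is bounded by step cubes and the potential `F + (2β+α)‖s_k‖³`
decreases by at least `2γ‖s_{k+1}‖³` (`Energy.step`). Hence the sum of cubes is bounded, and with it
the number of iterations. If a good step triggers the stopping test, `R` and the step are at most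
`ε₁`, and `τ` is chosen so that the output is an approximate second-order point.

Cost. The Hessian batch is at most `1 + c₂ ‖x_k - x̃‖²/ε₁²`. By Cauchy-Schwarz inside an epoch, the
squared displacement is at most the number of steps times the sum of their squares, and squares are
controlled by `1 +` cubes. Summing gives a cost of order `N K/m + c₂ m² K`, where `c₂` carries the
logarithm; `m ≈ N^{1/3}` balances the powers of `N`. All this is propagated as `Invariant`, by
`invariant_advance`.

Probabilistic part. A good iteration fails with probability at most `ζ` by a Hoeffding inequality
for sampling symmetric operators without replacement. It comes from an exchangeable pair (swap a
sampled index with an unsampled one): the derivative of the trace moment generating function is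
written through swaps and bounded by a mean value inequality for the trace exponential, which yields
a Grönwall inequality. Vectors are reduced to symmetric operators by Hermitian dilation. -/

namespace SVRC

/-! ### Matrix Hoeffding inequality without replacement, by exchangeable pairs -/

section Concentration

/-- Trapezoid rule for the convex function `exp`: its difference quotient is at most the mean of its
endpoint values. Multiplying by `(a - b) ^ 2` avoids the division and makes the statement symmetric.
-/
theorem exp_sub_exp_mul_le (a b : ℝ) :
    (Real.exp a - Real.exp b) * (a - b) ≤ 1 / 2 * (Real.exp a + Real.exp b) * (a - b) ^ 2 := by
  have key : ∀ x : ℝ, 0 ≤ x → Real.exp x - 1 ≤ x / 2 * (Real.exp x + 1) := by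
    intro x hx
    have hd : ∀ y : ℝ, HasDerivAt (fun y : ℝ => y / 2 * (Real.exp y + 1) - Real.exp y)
        (1 / 2 * (Real.exp y + 1) + y / 2 * Real.exp y - Real.exp y) y := by
      intro y
      exact (((hasDerivAt_id y).div_const 2).mul ((Real.hasDerivAt_exp y).add_const 1)).sub
        (Real.hasDerivAt_exp y)
    have hm : MonotoneOn (fun y : ℝ => y / 2 * (Real.exp y + 1) - Real.exp y) (Set.Ici 0) := by
      refine monotoneOn_of_deriv_nonneg (convex_Ici 0)
        (fun y _ => (hd y).continuousAt.continuousWithinAt)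
        (fun y _ => (hd y).differentiableAt.differentiableWithinAt) ?_
      intro y _
      rw [(hd y).deriv]
      -- Nonnegativity of the derivative is `1 - y ≤ e^{-y}` multiplied by `e^y / 2`.
      have h1 := Real.add_one_le_exp (-y)
      have h2 : Real.exp (-y) * Real.exp y = 1 := by rw [← Real.exp_add]; simp
      nlinarith [Real.exp_pos y]
    have := hm (Set.mem_Ici.2 le_rfl) (Set.mem_Ici.2 hx) hx
    simp only [Real.exp_zero] at this
    linarith
  have main : ∀ a b : ℝ, b ≤ a →
      (Real.exp a - Real.exp b) * (a - b) ≤ 1 / 2 * (Real.exp a + Real.exp b) * (a - b) ^ 2 := by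
    intro a b hab
    have h := key (a - b) (by linarith)
    have h1 : Real.exp a = Real.exp (a - b) * Real.exp b := by rw [← Real.exp_add]; simp
    have h2 := mul_le_mul_of_nonneg_right h
      (mul_nonneg (Real.exp_pos b).le (sub_nonneg.2 hab))
    rw [h1]
    nlinarith
  rcases le_total b a with h | h
  · exact main a b h
  · have := main b a h
    nlinarith

variable {V : Type*} [NormedAddCommGroup V] [InnerProductSpace ℝ V]

/-- `tr (e^{θA} T)` for the operator `A` with orthonormal eigenbasis `u` and eigenvalues `a`. -/
noncomputable def expTrace {D : ℕ} (θ : ℝ) (a : Fin D → ℝ) (u : OrthonormalBasis (Fin D) ℝ V)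
    (T : V →L[ℝ] V) : ℝ :=
  ∑ i, Real.exp (θ * a i) * inner ℝ (u i) (T (u i))

theorem expTrace_self {D : ℕ} (θ : ℝ) (a : Fin D → ℝ) (u : OrthonormalBasis (Fin D) ℝ V)
    (A : V →L[ℝ] V) (hA : ∀ i, A (u i) = a i • u i) :
    expTrace θ a u A = ∑ i, a i * Real.exp (θ * a i) := by
  unfold expTrace
  refine Finset.sum_congr rfl fun i _ => ?_
  rw [hA, inner_smul_right, real_inner_self_eq_norm_sq, u.orthonormal.1 i]
  ring

theorem expTrace_sum {D : ℕ} (θ : ℝ) (a : Fin D → ℝ) (u : OrthonormalBasis (Fin D) ℝ V)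
    {ι : Type*} (s : Finset ι) (T : ι → V →L[ℝ] V) :
    expTrace θ a u (∑ k ∈ s, T k) = ∑ k ∈ s, expTrace θ a u (T k) := by
  unfold expTrace
  rw [Finset.sum_comm]
  refine Finset.sum_congr rfl fun i _ => ?_
  rw [_root_.sum_apply, inner_sum, Finset.mul_sum]

theorem expTrace_smul {D : ℕ} (θ : ℝ) (a : Fin D → ℝ) (u : OrthonormalBasis (Fin D) ℝ V)
    (c : ℝ) (T : V →L[ℝ] V) :
    expTrace θ a u (c • T) = c * expTrace θ a u T := by
  unfold expTrace
  rw [Finset.mul_sum]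
  refine Finset.sum_congr rfl fun i _ => ?_
  rw [_root_.smul_apply, inner_smul_right]
  ring

/-- Mean value inequality for the trace exponential. -/
theorem expTrace_sub_le {D : ℕ} {θ : ℝ} (hθ : 0 ≤ θ) (a b : Fin D → ℝ)
    (u v : OrthonormalBasis (Fin D) ℝ V) (A B : V →L[ℝ] V)
    (hA : ∀ i, A (u i) = a i • u i) (hB : ∀ i, B (v i) = b i • v i)
    (hAs : ∀ x y, inner ℝ (A x) y = inner ℝ x (A y))
    (hBs : ∀ x y, inner ℝ (B x) y = inner ℝ x (B y))
    {c : ℝ} (hc : ‖A - B‖ ≤ c) :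
    expTrace θ a u (A - B) - expTrace θ b v (A - B) ≤
      θ / 2 * c ^ 2 * (∑ i, Real.exp (θ * a i) + ∑ i, Real.exp (θ * b i)) := by
  -- The overlaps of the two eigenbases. Since `⟨u i, (A - B) v j⟩ = (a i - b j) w i j`, both traces
  -- become double sums with the same weights `w i j ^ 2`, and the scalar trapezoid inequality
  -- applies to each pair `(a i, b j)`.
  set w : Fin D → Fin D → ℝ := fun i j => inner ℝ (u i) (v j) with hw
  have e1 : ∀ i j, inner ℝ ((A - B) (u i)) (v j) = (a i - b j) * w i j := by
    intro i j
    rw [_root_.sub_apply, inner_sub_left, hBs, hB, hA, inner_smul_left,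
      inner_smul_right]
    simp [hw]; ring
  have e2 : ∀ i j, inner ℝ (u i) ((A - B) (v j)) = (a i - b j) * w i j := by
    intro i j
    rw [_root_.sub_apply, inner_sub_right, ← hAs, hB, hA, inner_smul_left,
      inner_smul_right]
    simp [hw]; ring
  have f1 : ∀ i, inner ℝ (u i) ((A - B) (u i)) = ∑ j, (a i - b j) * w i j ^ 2 := by
    intro i
    rw [real_inner_comm, ← v.sum_inner_mul_inner]
    refine Finset.sum_congr rfl fun j _ => ?_
    rw [e1, real_inner_comm]; simp only [hw]; ring
  have f2 : ∀ j, inner ℝ (v j) ((A - B) (v j)) = ∑ i, (a i - b j) * w i j ^ 2 := by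
    intro j
    rw [← u.sum_inner_mul_inner]
    refine Finset.sum_congr rfl fun i _ => ?_
    rw [e2, real_inner_comm]; simp only [hw]; ring
  have hc0 : 0 ≤ c := (norm_nonneg _).trans hc
  -- By Parseval the row sum is `‖(A - B) (u i)‖ ^ 2`; column sums are treated likewise in `g2`.
  have g1 : ∀ i, ∑ j, (a i - b j) ^ 2 * w i j ^ 2 ≤ c ^ 2 := by
    intro i
    have : ∑ j, (a i - b j) ^ 2 * w i j ^ 2 = ‖(A - B) (u i)‖ ^ 2 := by
      rw [← real_inner_self_eq_norm_sq, ← v.sum_inner_mul_inner]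
      refine Finset.sum_congr rfl fun j _ => ?_
      rw [real_inner_comm ((A - B) (u i)) (v j), e1]; ring
    rw [this]
    have h := (A - B).le_of_opNorm_le hc (u i)
    rw [u.orthonormal.1 i, mul_one] at h
    exact pow_le_pow_left₀ (norm_nonneg _) h 2
  have g2 : ∀ j, ∑ i, (a i - b j) ^ 2 * w i j ^ 2 ≤ c ^ 2 := by
    intro j
    have : ∑ i, (a i - b j) ^ 2 * w i j ^ 2 = ‖(A - B) (v j)‖ ^ 2 := by
      rw [← real_inner_self_eq_norm_sq, ← u.sum_inner_mul_inner]
      refine Finset.sum_congr rfl fun i _ => ?_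
      rw [real_inner_comm (u i) ((A - B) (v j)), e2]; ring
    rw [this]
    have h := (A - B).le_of_opNorm_le hc (v j)
    rw [v.orthonormal.1 j, mul_one] at h
    exact pow_le_pow_left₀ (norm_nonneg _) h 2
  have t1 : expTrace θ a u (A - B) = ∑ i, ∑ j, Real.exp (θ * a i) * (a i - b j) * w i j ^ 2 := by
    unfold expTrace
    refine Finset.sum_congr rfl fun i _ => ?_
    rw [f1, Finset.mul_sum]
    exact Finset.sum_congr rfl fun j _ => by ring
  have t2 : expTrace θ b v (A - B) = ∑ i, ∑ j, Real.exp (θ * b j) * (a i - b j) * w i j ^ 2 := by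
    unfold expTrace
    rw [Finset.sum_comm]
    refine Finset.sum_congr rfl fun i _ => ?_
    rw [f2, Finset.mul_sum]
    exact Finset.sum_congr rfl fun j _ => by ring
  have hp : ∀ i j, (Real.exp (θ * a i) - Real.exp (θ * b j)) * (a i - b j) ≤
      θ / 2 * (Real.exp (θ * a i) + Real.exp (θ * b j)) * (a i - b j) ^ 2 := by
    intro i j
    rcases hθ.eq_or_lt with h | h
    · rw [← h]; simp
    · have := exp_sub_exp_mul_le (θ * a i) (θ * b j)
      refine le_of_mul_le_mul_left ?_ h
      nlinarith
  calc expTrace θ a u (A - B) - expTrace θ b v (A - B)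
      = ∑ i, ∑ j, ((Real.exp (θ * a i) - Real.exp (θ * b j)) * (a i - b j)) * w i j ^ 2 := by
        rw [t1, t2, ← Finset.sum_sub_distrib]
        refine Finset.sum_congr rfl fun i _ => ?_
        rw [← Finset.sum_sub_distrib]
        exact Finset.sum_congr rfl fun j _ => by ring
    _ ≤ ∑ i, ∑ j, (θ / 2 * (Real.exp (θ * a i) + Real.exp (θ * b j)) * (a i - b j) ^ 2)
          * w i j ^ 2 :=
        Finset.sum_le_sum fun i _ => Finset.sum_le_sum fun j _ =>
          mul_le_mul_of_nonneg_right (hp i j) (sq_nonneg _)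
    _ = θ / 2 * (∑ i, Real.exp (θ * a i) * ∑ j, (a i - b j) ^ 2 * w i j ^ 2)
          + θ / 2 * (∑ j, Real.exp (θ * b j) * ∑ i, (a i - b j) ^ 2 * w i j ^ 2) := by
        simp only [Finset.mul_sum]
        rw [Finset.sum_comm (f := fun j i => θ / 2 * (Real.exp (θ * b j) *
          ((a i - b j) ^ 2 * w i j ^ 2))), ← Finset.sum_add_distrib]
        refine Finset.sum_congr rfl fun i _ => ?_
        rw [← Finset.sum_add_distrib]
        exact Finset.sum_congr rfl fun j _ => by ring
    _ ≤ θ / 2 * (∑ i, Real.exp (θ * a i) * c ^ 2) + θ / 2 * (∑ j, Real.exp (θ * b j) * c ^ 2) := by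
        gcongr
        · exact g1 _
        · exact g2 _
    _ = _ := by
        rw [← Finset.sum_mul, ← Finset.sum_mul]; ring

/-- Grönwall: the differential inequality says exactly that `m θ * exp (-w θ²)` is nonincreasing on
`[0, ∞)`. -/
theorem le_mul_exp_sq_of_deriv_le {m m' : ℝ → ℝ} {w : ℝ} (hm : ∀ θ, HasDerivAt m (m' θ) θ)
    (h : ∀ θ, 0 ≤ θ → m' θ ≤ 2 * w * θ * m θ) {θ : ℝ} (hθ : 0 ≤ θ) :
    m θ ≤ m 0 * Real.exp (w * θ ^ 2) := by
  have hd : ∀ y : ℝ, HasDerivAt (fun y : ℝ => m y * Real.exp (-(w * y ^ 2)))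
      (m' y * Real.exp (-(w * y ^ 2)) + m y * (Real.exp (-(w * y ^ 2)) * (-(w * (2 * y))))) y := by
    intro y
    have h1 : HasDerivAt (fun y : ℝ => -(w * y ^ 2)) (-(w * (2 * y))) y := by
      have h2 := ((hasDerivAt_pow 2 y).const_mul w).neg
      simp only [Nat.cast_ofNat, Nat.add_one_sub_one, pow_one] at h2
      exact h2
    exact (hm y).mul h1.exp
  have ha : AntitoneOn (fun y : ℝ => m y * Real.exp (-(w * y ^ 2))) (Set.Ici 0) := by
    refine antitoneOn_of_deriv_nonpos (convex_Ici 0)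
      (fun y _ => (hd y).continuousAt.continuousWithinAt)
      (fun y _ => (hd y).differentiableAt.differentiableWithinAt) ?_
    intro y hy
    rw [interior_Ici] at hy
    rw [(hd y).deriv]
    have h1 := h y (le_of_lt hy)
    have h2 := mul_le_mul_of_nonneg_right h1 (Real.exp_pos (-(w * y ^ 2))).le
    nlinarith
  have := ha (Set.mem_Ici.2 le_rfl) (Set.mem_Ici.2 hθ) hθ
  simp only [ne_eq, OfNat.ofNat_ne_zero, not_false_eq_true, zero_pow, mul_zero, neg_zero,
    Real.exp_zero, mul_one] at this
  rw [Real.exp_neg] at this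
  have h3 := Real.exp_pos (w * θ ^ 2)
  rwa [mul_inv_le_iff₀ h3] at this

/-- Swapping an element of a set with an element of its complement is an exchangeable pair. -/
theorem sum_swap {N : ℕ} (n : ℕ) (G : Finset (Fin N) → Finset (Fin N) → ℝ) :
    ∑ ξ ∈ Finset.powersetCard n Finset.univ, ∑ i ∈ ξ, ∑ j ∈ ξᶜ, G ξ (insert j (ξ.erase i)) =
      ∑ ξ ∈ Finset.powersetCard n Finset.univ, ∑ i ∈ ξ, ∑ j ∈ ξᶜ,
        G (insert j (ξ.erase i)) ξ := by
  simp only [Finset.sum_sigma']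
  have aux : ∀ (ξ : Finset (Fin N)) (i j : Fin N), i ∈ ξ → j ∉ ξ →
      insert i ((insert j (ξ.erase i)).erase j) = ξ := by
    intro ξ i j hi hj
    rw [Finset.erase_insert (by simp [hj]), Finset.insert_erase hi]
  have auxc : ∀ (ξ : Finset (Fin N)) (i j : Fin N), i ∈ ξ → j ∉ ξ →
      (insert j (ξ.erase i)).card = ξ.card := by
    intro ξ i j hi hj
    rw [Finset.card_insert_of_notMem (by simp [hj]), Finset.card_erase_add_one hi]
  refine Finset.sum_nbij' (fun p => ⟨insert p.2.2 (p.1.erase p.2.1), ⟨p.2.2, p.2.1⟩⟩)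
    (fun p => ⟨insert p.2.2 (p.1.erase p.2.1), ⟨p.2.2, p.2.1⟩⟩) ?_ ?_ ?_ ?_ ?_
  · rintro ⟨ξ, i, j⟩ h
    simp only [Finset.mem_sigma, Finset.mem_powersetCard_univ, Finset.mem_compl] at h ⊢
    obtain ⟨h1, h2, h3⟩ := h
    refine ⟨by rw [auxc ξ i j h2 h3, h1], by simp, ?_⟩
    have : i ≠ j := fun e => h3 (e ▸ h2)
    simp [this]
  · rintro ⟨ξ, i, j⟩ h
    simp only [Finset.mem_sigma, Finset.mem_powersetCard_univ, Finset.mem_compl] at h ⊢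
    obtain ⟨h1, h2, h3⟩ := h
    refine ⟨by rw [auxc ξ i j h2 h3, h1], by simp, ?_⟩
    have : i ≠ j := fun e => h3 (e ▸ h2)
    simp [this]
  · rintro ⟨ξ, i, j⟩ h
    simp only [Finset.mem_sigma, Finset.mem_powersetCard_univ, Finset.mem_compl] at h
    simp only [aux ξ i j h.2.1 h.2.2]
  · rintro ⟨ξ, i, j⟩ h
    simp only [Finset.mem_sigma, Finset.mem_powersetCard_univ, Finset.mem_compl] at h
    simp only [aux ξ i j h.2.1 h.2.2]
  · rintro ⟨ξ, i, j⟩ h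
    simp only [Finset.mem_sigma, Finset.mem_powersetCard_univ, Finset.mem_compl] at h
    simp only [aux ξ i j h.2.1 h.2.2]

theorem sum_sub_sum_swap {N : ℕ} {W : Type*} [AddCommGroup W] (X : Fin N → W)
    {ξ : Finset (Fin N)} {i j : Fin N} (hi : i ∈ ξ) (hj : j ∉ ξ) :
    ∑ k ∈ ξ, X k - ∑ k ∈ insert j (ξ.erase i), X k = X i - X j := by
  rw [Finset.sum_insert (by simp [hj]), ← Finset.add_sum_erase ξ X hi]
  abel

/-- Bound on the trace moment generating function, summed over all samples of size `n`. The factor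
`n (N - n)` counts the swaps of a sample and yields the finite-population gain over independent
sampling. -/
theorem sum_exp_eigenvalues_le {N n D : ℕ} (hN : 1 ≤ N) (hn : n ≤ N) (X : Fin N → V →L[ℝ] V)
    (hX : ∀ i x y, inner ℝ (X i x) y = inner ℝ x (X i y)) (hsum : ∑ i, X i = 0)
    {c : ℝ} (hc : ∀ i j, ‖X i - X j‖ ≤ c) (a : Finset (Fin N) → Fin D → ℝ)
    (u : Finset (Fin N) → OrthonormalBasis (Fin D) ℝ V)
    (hu : ∀ ξ i, (∑ k ∈ ξ, X k) (u ξ i) = a ξ i • u ξ i) {θ : ℝ} (hθ : 0 ≤ θ) :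
    ∑ ξ ∈ Finset.powersetCard n Finset.univ, ∑ i, Real.exp (θ * a ξ i) ≤
      ((Finset.powersetCard n (Finset.univ : Finset (Fin N))).card * D : ℝ) *
        Real.exp (c ^ 2 * n * (N - n) / (4 * N) * θ ^ 2) := by
  set S := Finset.powersetCard n (Finset.univ : Finset (Fin N)) with hS
  have hN0 : (0 : ℝ) < N := by exact_mod_cast hN
  have hnN : (n : ℝ) ≤ N := by exact_mod_cast hn
  have hcard : ∀ ξ ∈ S, ξ.card = n := fun ξ h => (Finset.mem_powersetCard.1 h).2
  have hcardc : ∀ ξ ∈ S, (ξᶜ.card : ℝ) = N - n := by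
    intro ξ h
    rw [Finset.card_compl, hcard ξ h, Fintype.card_fin, Nat.cast_sub hn]
  have hYs : ∀ (ξ : Finset (Fin N)) x y,
      inner ℝ ((∑ k ∈ ξ, X k) x) y = inner ℝ x ((∑ k ∈ ξ, X k) y) := by
    intro ξ x y
    rw [_root_.sum_apply, _root_.sum_apply, sum_inner, inner_sum]
    exact Finset.sum_congr rfl fun k _ => hX k x y
  -- Stein-type identity: as `∑ X = 0`, the complement sums to `-Y`, so all swaps together
  -- contribute `(N - n) Y + n Y = N Y`.
  have hdec : ∀ ξ ∈ S, (N : ℝ) • ∑ k ∈ ξ, X k =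
      ∑ i ∈ ξ, ∑ j ∈ ξᶜ, (∑ k ∈ ξ, X k - ∑ k ∈ insert j (ξ.erase i), X k) := by
    intro ξ hξ
    have h1 : ∑ i ∈ ξ, ∑ j ∈ ξᶜ, (∑ k ∈ ξ, X k - ∑ k ∈ insert j (ξ.erase i), X k) =
        ∑ i ∈ ξ, ∑ j ∈ ξᶜ, (X i - X j) :=
      Finset.sum_congr rfl fun i hi => Finset.sum_congr rfl fun j hj =>
        sum_sub_sum_swap X hi (Finset.mem_compl.1 hj)
    rw [h1]
    have h2 : ∑ k ∈ ξᶜ, X k = -∑ k ∈ ξ, X k := by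
      rw [eq_neg_iff_add_eq_zero, add_comm, Finset.sum_add_sum_compl, hsum]
    simp only [Finset.sum_sub_distrib, Finset.sum_const, h2, ← Nat.cast_smul_eq_nsmul ℝ]
    rw [← Finset.smul_sum, hcard ξ hξ, hcardc ξ hξ, smul_neg, sub_neg_eq_add, ← add_smul]
    congr 1
    ring
  set m : ℝ → ℝ := fun θ => ∑ ξ ∈ S, ∑ i, Real.exp (θ * a ξ i) with hm
  set m' : ℝ → ℝ := fun θ => ∑ ξ ∈ S, expTrace θ (a ξ) (u ξ) (∑ k ∈ ξ, X k) with hm'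
  have hder : ∀ θ, HasDerivAt m (m' θ) θ := by
    intro θ
    refine HasDerivAt.fun_sum fun ξ _ => ?_
    rw [expTrace_self θ (a ξ) (u ξ) _ (hu ξ)]
    refine HasDerivAt.fun_sum fun i _ => ?_
    have := ((hasDerivAt_id θ).mul_const (a ξ i)).exp
    simpa [mul_comm] using this
  have hle : ∀ θ, 0 ≤ θ → m' θ ≤ 2 * (c ^ 2 * n * (N - n) / (4 * N)) * θ * m θ := by
    intro θ hθ
    have e1 : (N : ℝ) * m' θ = ∑ ξ ∈ S, ∑ i ∈ ξ, ∑ j ∈ ξᶜ, expTrace θ (a ξ) (u ξ)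
        (∑ k ∈ ξ, X k - ∑ k ∈ insert j (ξ.erase i), X k) := by
      simp only [hm', Finset.mul_sum]
      refine Finset.sum_congr rfl fun ξ hξ => ?_
      rw [← expTrace_smul, hdec ξ hξ, expTrace_sum]
      exact Finset.sum_congr rfl fun i _ => expTrace_sum _ _ _ _ _
    -- Exchangeability moves the exponential to the swapped sample at the price of a sign. Adding
    -- `e1` and `e2` leaves a difference of two trace exponentials, to which `expTrace_sub_le`
    -- applies.
    have e2 : (N : ℝ) * m' θ = ∑ ξ ∈ S, ∑ i ∈ ξ, ∑ j ∈ ξᶜ,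
        -expTrace θ (a (insert j (ξ.erase i))) (u (insert j (ξ.erase i)))
        (∑ k ∈ ξ, X k - ∑ k ∈ insert j (ξ.erase i), X k) := by
      rw [e1, sum_swap n (fun ξ η => expTrace θ (a ξ) (u ξ) (∑ k ∈ ξ, X k - ∑ k ∈ η, X k))]
      refine Finset.sum_congr rfl fun ξ _ => Finset.sum_congr rfl fun i _ =>
        Finset.sum_congr rfl fun j _ => ?_
      rw [← neg_sub, ← neg_one_smul ℝ, expTrace_smul]; ring
    have e3 : 2 * ((N : ℝ) * m' θ) ≤ ∑ ξ ∈ S, ∑ i ∈ ξ, ∑ j ∈ ξᶜ, θ / 2 * c ^ 2 *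
        (∑ i, Real.exp (θ * a ξ i) + ∑ k, Real.exp (θ * a (insert j (ξ.erase i)) k)) := by
      rw [two_mul]
      nth_rewrite 1 [e1]
      rw [e2]
      simp only [← Finset.sum_add_distrib]
      refine Finset.sum_le_sum fun ξ _ => Finset.sum_le_sum fun i hi =>
        Finset.sum_le_sum fun j hj => ?_
      rw [← sub_eq_add_neg, Finset.sum_add_distrib]
      refine expTrace_sub_le hθ _ _ _ _ _ _ (hu ξ) (hu _) (hYs ξ) (hYs _) ?_
      rw [sum_sub_sum_swap X hi (Finset.mem_compl.1 hj)]
      exact hc i j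
    have e4 : ∑ ξ ∈ S, ∑ i ∈ ξ, ∑ j ∈ ξᶜ, ∑ i, Real.exp (θ * a ξ i) =
        n * (N - n) * m θ := by
      rw [hm, Finset.mul_sum]
      refine Finset.sum_congr rfl fun ξ hξ => ?_
      rw [Finset.sum_const, Finset.sum_const, nsmul_eq_mul, nsmul_eq_mul, hcard ξ hξ,
        hcardc ξ hξ]
      ring
    have e5 : ∑ ξ ∈ S, ∑ i ∈ ξ, ∑ j ∈ ξᶜ, ∑ k, Real.exp (θ * a (insert j (ξ.erase i)) k) =
        n * (N - n) * m θ := by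
      rw [← e4, sum_swap n (fun ξ η => ∑ k, Real.exp (θ * a η k))]
    have e6 : 2 * ((N : ℝ) * m' θ) ≤ θ / 2 * c ^ 2 * (n * (N - n) * m θ + n * (N - n) * m θ) := by
      refine e3.trans (le_of_eq ?_)
      nth_rewrite 1 [← e4]
      rw [← e5]
      simp only [← Finset.sum_add_distrib, Finset.mul_sum]
    have e7 : 2 * (c ^ 2 * n * (N - n) / (4 * N)) * θ * m θ =
        (θ / 2 * c ^ 2 * (n * (N - n) * m θ + n * (N - n) * m θ)) / (2 * N) := by
      field_simp
      ring
    rw [e7, le_div_iff₀ (by positivity)]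
    linarith
  have h := le_mul_exp_sq_of_deriv_le hder hle hθ
  have h0 : m 0 = S.card * D := by simp [hm]
  rw [h0] at h
  exact h

/-- Chernoff bound: a quadratic form exceeding `s‖v‖²` forces an eigenvalue above `s`, so every such
sample contributes at least `e^{θ s}` to the sum of exponentials. -/
theorem card_lt_quadForm_sum_le [FiniteDimensional ℝ V] {N n : ℕ} (hN : 1 ≤ N)
    (hn : n ≤ N) (X : Fin N → V →L[ℝ] V)
    (hX : ∀ i x y, inner ℝ (X i x) y = inner ℝ x (X i y)) (hsum : ∑ i, X i = 0)
    {c : ℝ} (hc : ∀ i j, ‖X i - X j‖ ≤ c) {s θ : ℝ} (hθ : 0 ≤ θ)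
    (P : Finset (Fin N) → Prop) [DecidablePred P]
    (hP : ∀ ξ, P ξ → ∃ v, s * ‖v‖ ^ 2 < inner ℝ v ((∑ k ∈ ξ, X k) v)) :
    (((Finset.powersetCard n Finset.univ).filter P).card : ℝ) ≤
      ((Finset.powersetCard n (Finset.univ : Finset (Fin N))).card * Module.finrank ℝ V : ℝ) *
        Real.exp (c ^ 2 * n * (N - n) / (4 * N) * θ ^ 2 - θ * s) := by
  have hYs : ∀ ξ : Finset (Fin N), ((∑ k ∈ ξ, X k : V →L[ℝ] V) : V →ₗ[ℝ] V).IsSymmetric := by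
    intro ξ x y
    simp only [ContinuousLinearMap.coe_coe]
    rw [_root_.sum_apply, _root_.sum_apply, sum_inner, inner_sum]
    exact Finset.sum_congr rfl fun k _ => hX k x y
  set a : Finset (Fin N) → Fin (Module.finrank ℝ V) → ℝ := fun ξ => (hYs ξ).eigenvalues rfl
  set u : Finset (Fin N) → OrthonormalBasis (Fin (Module.finrank ℝ V)) ℝ V :=
    fun ξ => (hYs ξ).eigenvectorBasis rfl
  have hu : ∀ ξ i, (∑ k ∈ ξ, X k) (u ξ i) = a ξ i • u ξ i := by
    intro ξ i
    exact (hYs ξ).apply_eigenvectorBasis rfl i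
  have hmgf := sum_exp_eigenvalues_le hN hn X hX hsum hc a u hu hθ
  have hlow : (((Finset.powersetCard n Finset.univ).filter P).card : ℝ) * Real.exp (θ * s) ≤
      ∑ ξ ∈ Finset.powersetCard n Finset.univ, ∑ i, Real.exp (θ * a ξ i) := by
    rw [← nsmul_eq_mul, ← Finset.sum_const]
    refine (Finset.sum_le_sum fun ξ hξ => ?_).trans
      (Finset.sum_le_sum_of_subset_of_nonneg (Finset.filter_subset P _)
        fun ξ _ _ => Finset.sum_nonneg fun i _ => (Real.exp_pos _).le)
    obtain ⟨v, hv⟩ := hP ξ (Finset.mem_filter.1 hξ).2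
    have : ∃ i, s < a ξ i := by
      by_contra! hcon
      refine absurd hv (not_lt.2 ?_)
      rw [← (u ξ).sum_inner_mul_inner, ← real_inner_self_eq_norm_sq v,
        ← (u ξ).sum_inner_mul_inner v v, Finset.mul_sum]
      refine Finset.sum_le_sum fun i _ => ?_
      have h1 : inner ℝ (u ξ i) ((∑ k ∈ ξ, X k) v) = a ξ i * inner ℝ (u ξ i) v := by
        have := hYs ξ (u ξ i) v
        simp only [ContinuousLinearMap.coe_coe] at this
        rw [← this, hu, inner_smul_left]; simp
      rw [h1, real_inner_comm v (u ξ i)]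
      nlinarith [hcon i, mul_self_nonneg (inner ℝ v (u ξ i) : ℝ)]
    obtain ⟨i, hi⟩ := this
    refine le_trans ?_ (Finset.single_le_sum (f := fun i => Real.exp (θ * a ξ i))
      (fun i _ => (Real.exp_pos _).le) (Finset.mem_univ i))
    exact Real.exp_le_exp.2 (mul_le_mul_of_nonneg_left hi.le hθ)
  rw [Real.exp_sub, ← mul_div_assoc, le_div_iff₀ (Real.exp_pos _)]
  exact hlow.trans hmgf

/-- Hoeffding's inequality for sampling symmetric operators without replacement. -/
theorem card_lt_quadForm_mean_le [FiniteDimensional ℝ V] {N n : ℕ} (hn0 : 1 ≤ n)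
    (hn : n ≤ N) (X : Fin N → V →L[ℝ] V)
    (hX : ∀ i x y, inner ℝ (X i x) y = inner ℝ x (X i y))
    {b ℓ t : ℝ} (hb : ∀ i, ‖X i‖ ≤ b) (ht : 0 < t) (hℓ : 0 ≤ ℓ)
    (hbt : 16 * b ^ 2 * ℓ * (1 / n - 1 / N) ≤ t ^ 2)
    (P : Finset (Fin N) → Prop) [DecidablePred P]
    (hP : ∀ ξ, P ξ → ∃ v, t * ‖v‖ ^ 2 < inner ℝ v
      (((1 / (ξ.card : ℝ)) • ∑ k ∈ ξ, X k - (1 / (N : ℝ)) • ∑ k, X k) v)) :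
    (((Finset.powersetCard n Finset.univ).filter P).card : ℝ) ≤
      ((Finset.powersetCard n (Finset.univ : Finset (Fin N))).card * Module.finrank ℝ V : ℝ) *
        Real.exp (-ℓ) := by
  have hN : 1 ≤ N := hn0.trans hn
  have hN0 : (0 : ℝ) < N := by exact_mod_cast hN
  have hn0' : (0 : ℝ) < n := by exact_mod_cast hn0
  set μ : V →L[ℝ] V := (1 / (N : ℝ)) • ∑ k, X k with hμ
  set Z : Fin N → V →L[ℝ] V := fun i => X i - μ with hZ
  have hμs : ∀ x y, inner ℝ (μ x) y = inner ℝ x (μ y) := by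
    intro x y
    rw [hμ, _root_.smul_apply, _root_.smul_apply, inner_smul_left, inner_smul_right,
      _root_.sum_apply, _root_.sum_apply, sum_inner, inner_sum]
    simp only [hX]; simp
  have hZs : ∀ i x y, inner ℝ (Z i x) y = inner ℝ x (Z i y) := by
    intro i x y
    simp only [hZ, _root_.sub_apply, inner_sub_left, inner_sub_right, hX, hμs]
  have hZsum : ∑ i, Z i = 0 := by
    simp only [hZ, Finset.sum_sub_distrib, Finset.sum_const, Finset.card_univ, Fintype.card_fin,
      ← Nat.cast_smul_eq_nsmul ℝ, hμ, smul_smul]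
    rw [mul_one_div_cancel hN0.ne', one_smul, sub_self]
  have hc : ∀ i j, ‖Z i - Z j‖ ≤ 2 * b := by
    intro i j
    have : Z i - Z j = X i - X j := by simp [hZ]
    rw [this, two_mul]
    exact (norm_sub_le _ _).trans (add_le_add (hb i) (hb j))
  have hmean : ∀ ξ : Finset (Fin N), 0 < ξ.card →
      ∑ k ∈ ξ, Z k = (ξ.card : ℝ) • ((1 / (ξ.card : ℝ)) • ∑ k ∈ ξ, X k - μ) := by
    intro ξ h
    have h' : (ξ.card : ℝ) ≠ 0 := by exact_mod_cast h.ne'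
    simp only [hZ, Finset.sum_sub_distrib, Finset.sum_const,
      ← Nat.cast_smul_eq_nsmul ℝ, smul_sub, smul_smul]
    rw [mul_one_div_cancel h', one_smul]
  classical
  have main : ∀ θ, 0 ≤ θ → (((Finset.powersetCard n Finset.univ).filter P).card : ℝ) ≤
      ((Finset.powersetCard n (Finset.univ : Finset (Fin N))).card * Module.finrank ℝ V : ℝ) *
        Real.exp ((2 * b) ^ 2 * n * (N - n) / (4 * N) * θ ^ 2 - θ * (n * t)) := by
    intro θ hθ
    have := card_lt_quadForm_sum_le hN hn Z hZs hZsum hc hθ (s := n * t)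
      (fun ξ => P ξ ∧ ξ.card = n) (by
        rintro ξ ⟨h1, h2⟩
        obtain ⟨v, hv⟩ := hP ξ h1
        refine ⟨v, ?_⟩
        rw [hmean ξ (by omega), _root_.smul_apply, inner_smul_right, h2, mul_assoc]
        rw [h2] at hv
        exact mul_lt_mul_of_pos_left hv hn0')
    refine le_trans (le_of_eq ?_) this
    congr 2
    refine Finset.filter_congr fun ξ hξ => ?_
    simp [(Finset.mem_powersetCard.1 hξ).2]
  -- With this `θ` the linear term is `-2ℓ` and `hbt` bounds the quadratic term by `ℓ / 4`, which
  -- leaves room below `-ℓ`.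
  refine (main (2 * ℓ / (n * t)) (by positivity)).trans ?_
  refine mul_le_mul_of_nonneg_left (Real.exp_le_exp.2 ?_) (by positivity)
  have e1 : 2 * ℓ / (n * t) * (n * t) = 2 * ℓ := by field_simp
  have e2 : (2 * b) ^ 2 * n * (N - n) / (4 * N) * (2 * ℓ / (n * t)) ^ 2 =
      (16 * b ^ 2 * ℓ * (1 / n - 1 / N)) * (ℓ / 4) / t ^ 2 := by
    field_simp
    ring
  rw [e1, e2]
  have e3 : (16 * b ^ 2 * ℓ * (1 / n - 1 / N)) * (ℓ / 4) / t ^ 2 ≤ ℓ / 4 := by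
    rw [div_le_iff₀ (by positivity)]
    nlinarith
  linarith

end Concentration

/-! ### Batch sizes and tail bounds for the estimators -/

section Sampling

variable {V : Type*} [NormedAddCommGroup V] [InnerProductSpace ℝ V]

theorem one_le_batchSize (N : ℕ) (a b : ℝ) : 1 ≤ batchSize N a b := le_max_left _ _

theorem batchSize_le {N : ℕ} (hN : 1 ≤ N) {a b : ℝ} (ha : 0 < a) (hb : 0 ≤ b) :
    batchSize N a b ≤ N := by
  have hN0 : (0 : ℝ) < N := by exact_mod_cast hN
  refine max_le hN (Nat.ceil_le.2 ?_)
  rw [div_le_iff₀ (by positivity)]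
  nlinarith [mul_pos hN0 (mul_pos hN0 ha)]

/-- The accuracy side of the batch size: `1/n - 1/N` is the variance factor of sampling without
replacement. The cost side is `batchSize_le_one_add`. -/
theorem mul_one_div_batchSize_sub_le {N : ℕ} (hN : 1 ≤ N) {a b : ℝ} (ha : 0 < a) (hb : 0 ≤ b) :
    b * (1 / (batchSize N a b : ℝ) - 1 / N) ≤ a := by
  have hN0 : (0 : ℝ) < N := by exact_mod_cast hN
  have hn0 : (0 : ℝ) < batchSize N a b := by exact_mod_cast one_le_batchSize N a b
  have h1 : (N * b) / (b + N * a) ≤ (batchSize N a b : ℝ) :=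
    (Nat.le_ceil _).trans (by exact_mod_cast le_max_right _ _)
  rw [div_le_iff₀ (by positivity)] at h1
  have h2 : b * (1 / (batchSize N a b : ℝ) - 1 / N) =
      (b * (N - batchSize N a b)) / (N * batchSize N a b) := by
    field_simp
  rw [h2, div_le_iff₀ (by positivity)]
  nlinarith

theorem batchSize_le_one_add {N : ℕ} (hN : 1 ≤ N) {a b : ℝ} (ha : 0 < a) (hb : 0 ≤ b) :
    (batchSize N a b : ℝ) ≤ 1 + b / a := by
  have hN0 : (0 : ℝ) < N := by exact_mod_cast hN
  have h0 : 0 ≤ b / a := by positivity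
  unfold batchSize
  rw [Nat.cast_max]
  refine max_le (by simpa using h0) ?_
  refine (Nat.ceil_lt_add_one (by positivity)).le.trans ?_
  rw [add_comm]
  gcongr ?_ + ?_
  · simp
  rw [div_le_div_iff₀ (by positivity) ha]
  nlinarith [mul_nonneg hb hb]

theorem sampleSubset_outer_le {N n : ℕ} (hn : n ≤ N) (P : Finset (Fin N) → Prop)
    [DecidablePred P] {p : ℝ}
    (h : (((Finset.powersetCard n Finset.univ).filter P).card : ℝ) ≤
      (Finset.powersetCard n (Finset.univ : Finset (Fin N))).card * p) :
    (sampleSubset N n).toOuterMeasure {ξ | P ξ} ≤ ENNReal.ofReal p := by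
  classical
  unfold sampleSubset
  rw [PMF.toOuterMeasure_uniformOfFinset_apply]
  simp only [min_eq_left hn, Set.mem_ofPred_eq]
  have hpos : 0 < (Finset.powersetCard n (Finset.univ : Finset (Fin N))).card := by
    rw [Finset.card_powersetCard]
    simpa using Nat.choose_pos hn
  refine ENNReal.div_le_of_le_mul ?_
  rw [← ENNReal.ofReal_natCast, ← ENNReal.ofReal_natCast, mul_comm,
    ← ENNReal.ofReal_mul (by positivity)]
  refine ENNReal.ofReal_le_ofReal (le_trans (le_of_eq ?_) h)
  norm_cast

theorem mem_support_sampleSubset {N n : ℕ} (hn : n ≤ N) {ξ : Finset (Fin N)}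
    (h : ξ ∈ (sampleSubset N n).support) : ξ.card = n := by
  unfold sampleSubset at h
  rw [PMF.mem_support_uniformOfFinset_iff, min_eq_left hn] at h
  exact (Finset.mem_powersetCard.1 h).2

theorem sampleSubset_quadForm_le [FiniteDimensional ℝ V] {N : ℕ} (hN : 1 ≤ N)
    (X : Fin N → V →L[ℝ] V) (hX : ∀ i x y, inner ℝ (X i x) y = inner ℝ x (X i y))
    {b ℓ t : ℝ} (hb : ∀ i, ‖X i‖ ≤ b) (ht : 0 < t) (hℓ : 0 ≤ ℓ) (P : Finset (Fin N) → Prop)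
    (hP : ∀ ξ, P ξ → ∃ v, t * ‖v‖ ^ 2 < inner ℝ v
      (((1 / (ξ.card : ℝ)) • ∑ k ∈ ξ, X k - (1 / (N : ℝ)) • ∑ k, X k) v)) :
    (sampleSubset N (batchSize N (t ^ 2) (64 * b ^ 2 * ℓ))).toOuterMeasure {ξ | P ξ} ≤
      ENNReal.ofReal (Module.finrank ℝ V * Real.exp (-ℓ)) := by
  classical
  have hnN := batchSize_le hN (pow_pos ht 2) (b := 64 * b ^ 2 * ℓ) (by positivity)
  refine sampleSubset_outer_le hnN P ?_
  rw [← mul_assoc]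
  refine card_lt_quadForm_mean_le (one_le_batchSize _ _ _) hnN X hX hb ht hℓ ?_ P hP
  have h1 := mul_one_div_batchSize_sub_le hN (pow_pos ht 2) (b := 64 * b ^ 2 * ℓ) (by positivity)
  have h2 : (0 : ℝ) ≤ 1 / (batchSize N (t ^ 2) (64 * b ^ 2 * ℓ) : ℝ) - 1 / N := by
    rw [sub_nonneg]
    refine one_div_le_one_div_of_le ?_ (by exact_mod_cast hnN)
    exact_mod_cast one_le_batchSize _ _ _
  have h3 : 0 ≤ b ^ 2 * ℓ * (1 / (batchSize N (t ^ 2) (64 * b ^ 2 * ℓ) : ℝ) - 1 / N) := by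
    positivity
  linarith

/-- The Hermitian dilation of a vector, as a linear map. -/
noncomputable def dilationLinear (g : V) : WithLp 2 (ℝ × V) →ₗ[ℝ] WithLp 2 (ℝ × V) where
  toFun p := WithLp.toLp 2 (inner ℝ g p.snd, p.fst • g)
  map_add' p q := by simp [inner_add_right, add_smul, ← WithLp.toLp_add]
  map_smul' c p := by simp [inner_smul_right, mul_smul, ← WithLp.toLp_smul]

theorem dilationLinear_apply (g : V) (p : WithLp 2 (ℝ × V)) :
    dilationLinear g p = WithLp.toLp 2 (inner ℝ g p.snd, p.fst • g) := rfl

theorem norm_dilationLinear_le (g : V) (p : WithLp 2 (ℝ × V)) :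
    ‖dilationLinear g p‖ ≤ ‖g‖ * ‖p‖ := by
  refine le_of_sq_le_sq ?_ (by positivity)
  rw [mul_pow, WithLp.prod_norm_sq_eq_of_L2, WithLp.prod_norm_sq_eq_of_L2, dilationLinear_apply]
  change ‖(inner ℝ g p.snd : ℝ)‖ ^ 2 + ‖p.fst • g‖ ^ 2 ≤ _
  rw [norm_smul, mul_pow]
  have h2 := pow_le_pow_left₀ (abs_nonneg _) (abs_real_inner_le_norm g p.snd) 2
  rw [Real.norm_eq_abs]
  nlinarith

/-- The Hermitian dilation of a vector. -/
noncomputable def dilation : V →ₗ[ℝ] WithLp 2 (ℝ × V) →L[ℝ] WithLp 2 (ℝ × V) where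
  toFun g := (dilationLinear g).mkContinuous ‖g‖ (norm_dilationLinear_le g)
  map_add' g h := by
    refine ContinuousLinearMap.ext fun p => ?_
    simp [dilationLinear_apply, inner_add_left, ← WithLp.toLp_add]
  map_smul' c g := by
    refine ContinuousLinearMap.ext fun p => ?_
    simp [dilationLinear_apply, inner_smul_left, smul_comm c, ← WithLp.toLp_smul]

theorem dilation_apply (g : V) (p : WithLp 2 (ℝ × V)) :
    dilation g p = WithLp.toLp 2 (inner ℝ g p.snd, p.fst • g) := rfl

theorem norm_dilation_le (g : V) : ‖dilation g‖ ≤ ‖g‖ :=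
  LinearMap.mkContinuous_norm_le _ (norm_nonneg _) (norm_dilationLinear_le g)

theorem inner_dilation (g : V) (p q : WithLp 2 (ℝ × V)) :
    inner ℝ p (dilation g q) = p.fst * inner ℝ g q.snd + q.fst * inner ℝ g p.snd := by
  rw [WithLp.prod_inner_apply, dilation_apply]
  simp [inner_smul_right, real_inner_comm, mul_comm]

/-- The dilation of a vector turns its norm into a value of a quadratic form, so the one-sided
operator bound suffices; the extra real coordinate is the source of the dimension factor `d + 1`. -/
theorem sampleSubset_norm_le [FiniteDimensional ℝ V] {N : ℕ} (hN : 1 ≤ N)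
    (X : Fin N → V) {b ℓ t : ℝ} (hb : ∀ i, ‖X i‖ ≤ b) (ht : 0 < t) (hℓ : 0 ≤ ℓ) :
    (sampleSubset N (batchSize N (t ^ 2) (64 * b ^ 2 * ℓ))).toOuterMeasure
      {ξ | ¬ ‖(1 / (ξ.card : ℝ)) • ∑ k ∈ ξ, X k - (1 / (N : ℝ)) • ∑ k, X k‖ ≤ t} ≤
      ENNReal.ofReal ((Module.finrank ℝ V + 1) * Real.exp (-ℓ)) := by
  have hfin : Module.finrank ℝ (WithLp 2 (ℝ × V)) = Module.finrank ℝ V + 1 := by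
    rw [(WithLp.linearEquiv 2 ℝ (ℝ × V)).finrank_eq, Module.finrank_prod, Module.finrank_self,
      add_comm]
  have : FiniteDimensional ℝ (WithLp 2 (ℝ × V)) :=
    (WithLp.linearEquiv 2 ℝ (ℝ × V)).symm.finiteDimensional
  have := sampleSubset_quadForm_le hN (fun i => dilation (X i)) (by
      intro i p q
      rw [real_inner_comm, inner_dilation, inner_dilation]; ring)
    (fun i => (norm_dilation_le (X i)).trans (hb i)) ht hℓ
    (fun ξ => ¬ ‖(1 / (ξ.card : ℝ)) • ∑ k ∈ ξ, X k - (1 / (N : ℝ)) • ∑ k, X k‖ ≤ t) (by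
      intro ξ hξ
      rw [not_le] at hξ
      have e : (1 / (ξ.card : ℝ)) • ∑ k ∈ ξ, dilation (X k) - (1 / (N : ℝ)) • ∑ k, dilation (X k) =
          dilation ((1 / (ξ.card : ℝ)) • ∑ k ∈ ξ, X k - (1 / (N : ℝ)) • ∑ k, X k) := by
        rw [map_sub, map_smul, map_smul, map_sum, map_sum]
      rw [e]
      set w := (1 / (ξ.card : ℝ)) • ∑ k ∈ ξ, X k - (1 / (N : ℝ)) • ∑ k, X k
      have hw : 0 < ‖w‖ := ht.trans hξ
      -- Top eigenvector of the dilation: its quadratic form is `2‖w‖³`, its squared norm `2‖w‖²`.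
      refine ⟨WithLp.toLp 2 (‖w‖, w), ?_⟩
      rw [inner_dilation, WithLp.prod_norm_sq_eq_of_L2]
      change t * (‖‖w‖‖ ^ 2 + ‖w‖ ^ 2) < ‖w‖ * inner ℝ w w + ‖w‖ * inner ℝ w w
      rw [norm_norm, real_inner_self_eq_norm_sq]
      nlinarith [pow_pos hw 2])
  rw [hfin] at this
  exact_mod_cast this

theorem norm_apply_le_of_quadForm_le {A : V →L[ℝ] V}
    (hA : ∀ x y, inner ℝ (A x) y = inner ℝ x (A y)) {t : ℝ}
    (h1 : ∀ v, inner ℝ v (A v) ≤ t * ‖v‖ ^ 2) (h2 : ∀ v, -(t * ‖v‖ ^ 2) ≤ inner ℝ v (A v)) (v : V) :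
    ‖A v‖ ≤ t * ‖v‖ := by
  rcases (norm_nonneg (A v)).eq_or_lt with h0 | h0
  · rw [← h0]
    rcases (norm_nonneg v).eq_or_lt with h | h
    · rw [← h]; simp
    · have := h1 v
      have h3 := h2 v
      have : 0 ≤ t * ‖v‖ * ‖v‖ := by nlinarith
      exact nonneg_of_mul_nonneg_left this h
  · have hv : 0 < ‖v‖ := by
      rw [norm_pos_iff]; rintro rfl; simp at h0
    -- Rescale `A v` to the length of `v`, so that `⟨w, A v⟩ = ‖v‖ ‖A v‖`; polarization and the
    -- parallelogram law then bound it by the quadratic form.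
    set c := ‖v‖ / ‖A v‖ with hc
    set w := c • A v with hw
    have hwn : ‖w‖ = ‖v‖ := by
      rw [hw, norm_smul, hc, Real.norm_of_nonneg (by positivity)]
      field_simp
    have e1 : inner ℝ (v + w) (A (v + w)) - inner ℝ (v - w) (A (v - w)) =
        4 * inner ℝ w (A v) := by
      have := hA w v
      rw [real_inner_comm] at this
      simp only [map_add, map_sub, inner_add_left, inner_add_right, inner_sub_left,
        inner_sub_right]
      linarith
    have e2 : inner ℝ w (A v) = ‖v‖ * ‖A v‖ := by
      rw [hw, inner_smul_left, real_inner_self_eq_norm_sq, hc]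
      simp
      field_simp
    have e3 := parallelogram_law_with_norm ℝ v w
    have i1 := h1 (v + w)
    have i2 := h2 (v - w)
    rw [hwn] at e3
    have e4 : t * ‖v + w‖ ^ 2 + t * ‖v - w‖ ^ 2 = 4 * (‖v‖ * (t * ‖v‖)) := by
      linear_combination t * e3
    have : ‖v‖ * ‖A v‖ ≤ ‖v‖ * (t * ‖v‖) := by
      rw [e2] at e1
      linarith
    exact le_of_mul_le_mul_left this hv

/-- Hoeffding's inequality, two-sided, for the operator norm. -/
theorem sampleSubset_opNorm_le [FiniteDimensional ℝ V] {N : ℕ} (hN : 1 ≤ N)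
    (X : Fin N → V →L[ℝ] V) (hX : ∀ i x y, inner ℝ (X i x) y = inner ℝ x (X i y))
    {b ℓ t : ℝ} (hb : ∀ i, ‖X i‖ ≤ b) (ht : 0 < t) (hℓ : 0 ≤ ℓ) :
    (sampleSubset N (batchSize N (t ^ 2) (64 * b ^ 2 * ℓ))).toOuterMeasure
      {ξ | ¬ ‖(1 / (ξ.card : ℝ)) • ∑ k ∈ ξ, X k - (1 / (N : ℝ)) • ∑ k, X k‖ ≤ t} ≤
      ENNReal.ofReal (2 * (Module.finrank ℝ V * Real.exp (-ℓ))) := by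
  have h1 := sampleSubset_quadForm_le hN X hX hb ht hℓ
    (fun ξ => ∃ v, t * ‖v‖ ^ 2 < inner ℝ v
      (((1 / (ξ.card : ℝ)) • ∑ k ∈ ξ, X k - (1 / (N : ℝ)) • ∑ k, X k) v)) (fun ξ h => h)
  have h2 := sampleSubset_quadForm_le hN (fun i => -X i) (by simpa using hX)
    (by simpa using hb) ht hℓ
    (fun ξ => ∃ v, inner ℝ v
      (((1 / (ξ.card : ℝ)) • ∑ k ∈ ξ, X k - (1 / (N : ℝ)) • ∑ k, X k) v) < -(t * ‖v‖ ^ 2)) (by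
      rintro ξ ⟨v, hv⟩
      refine ⟨v, ?_⟩
      have e : (1 / (ξ.card : ℝ)) • ∑ k ∈ ξ, -X k - (1 / (N : ℝ)) • ∑ k, -X k =
          -((1 / (ξ.card : ℝ)) • ∑ k ∈ ξ, X k - (1 / (N : ℝ)) • ∑ k, X k) := by
        simp only [Finset.sum_neg_distrib, smul_neg]; abel
      rw [e, _root_.neg_apply, inner_neg_right]
      linarith)
  rw [two_mul, ENNReal.ofReal_add (by positivity) (by positivity)]
  refine le_trans (le_trans (MeasureTheory.measure_mono ?_) (MeasureTheory.measure_union_le _ _))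
    (add_le_add h1 h2)
  intro ξ hξ
  by_contra hcon
  simp only [Set.mem_union, Set.mem_ofPred_eq, not_or, not_exists, not_lt] at hcon
  refine hξ (ContinuousLinearMap.opNorm_le_bound _ ht.le fun v => ?_)
  refine norm_apply_le_of_quadForm_le ?_ hcon.1 hcon.2 v
  have hYs : ∀ (ξ : Finset (Fin N)) x y,
      inner ℝ ((∑ k ∈ ξ, X k) x) y = inner ℝ x ((∑ k ∈ ξ, X k) y) := by
    intro ξ x y
    rw [_root_.sum_apply, _root_.sum_apply, sum_inner, inner_sum]
    exact Finset.sum_congr rfl fun k _ => hX k x y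
  intro x y
  simp only [_root_.sub_apply, _root_.smul_apply, inner_sub_left, inner_sub_right,
    real_inner_smul_left, real_inner_smul_right, hYs]

end Sampling

/-! ### Symmetry of the Hessian and Taylor estimates -/

section Calculus

variable {d : ℕ}

theorem hasFDerivAt_gradient {F : E d → ℝ} (hF : ContDiff ℝ 2 F) (x : E d) :
    HasFDerivAt (gradient F) (hess F x) x := by
  have h1 : DifferentiableAt ℝ (fderiv ℝ F) x :=
    (hF.fderiv_right (m := 1) (by norm_num)).differentiable (by norm_num) x
  have h2 : DifferentiableAt ℝ (gradient F) x := by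
    exact ((InnerProductSpace.toDual ℝ (E d)).symm.toContinuousLinearEquiv.differentiable _).comp x h1
  exact h2.hasFDerivAt

theorem hasGradientAt_of_contDiff {F : E d → ℝ} (hF : ContDiff ℝ 2 F) (x : E d) :
    HasGradientAt F (gradient F x) x :=
  (hF.differentiable (by norm_num) x).hasGradientAt

theorem hess_symm {F : E d → ℝ} (hF : ContDiff ℝ 2 F) (x u v : E d) :
    inner ℝ (hess F x u) v = inner ℝ u (hess F x v) := by
  have h1 : DifferentiableAt ℝ (fderiv ℝ F) x :=
    (hF.fderiv_right (m := 1) (by norm_num)).differentiable (by norm_num) x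
  have hs : IsSymmSndFDerivAt ℝ F x := hF.contDiffAt.isSymmSndFDerivAt (by simp)
  -- Differentiating `y ↦ ⟨∇F y, b⟩ = DF(y) b` in two ways identifies `hess` with the second Fréchet
  -- derivative.
  have key : ∀ a b : E d, inner ℝ (hess F x a) b = fderiv ℝ (fderiv ℝ F) x a b := by
    intro a b
    have e : (fun y => fderiv ℝ F y b) = fun y => inner ℝ (gradient F y) b := by
      funext y; simp [gradient]
    have h3 := (hasFDerivAt_gradient hF x).inner ℝ (hasFDerivAt_const b x)
    have h4 := h1.hasFDerivAt.clm_apply (hasFDerivAt_const b x)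
    rw [e] at h4
    have h5 := congrArg (fun T => T a) (h3.unique h4)
    simpa [fderivInnerCLM_apply] using h5
  rw [key, hs, ← key, real_inner_comm]

theorem norm_gradient_sub_sub_le {F : E d → ℝ} (hF : ContDiff ℝ 2 F) {L : ℝ}
    (hL : ∀ x y, ‖hess F x - hess F y‖ ≤ L * ‖x - y‖) (x s : E d) :
    ‖gradient F (x + s) - gradient F x - hess F x s‖ ≤ L / 2 * ‖s‖ ^ 2 := by
  have hd : ∀ t : ℝ, HasDerivAt (fun t : ℝ => gradient F (x + t • s) - gradient F x - t • hess F x s)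
      (hess F (x + t • s) s - hess F x s) t := by
    intro t
    have h1 : HasDerivAt (fun t : ℝ => x + t • s) s t := by
      simpa using ((hasDerivAt_id t).smul_const s).const_add x
    have h2 := (hasFDerivAt_gradient hF (x + t • s)).comp_hasDerivAt t h1
    have h3 : HasDerivAt (fun t : ℝ => t • hess F x s) (hess F x s) t := by
      simpa using (hasDerivAt_id t).smul_const (hess F x s)
    exact (h2.sub_const _).sub h3
  have hB : ∀ t : ℝ, HasDerivAt (fun t : ℝ => L * ‖s‖ ^ 2 / 2 * t ^ 2) (L * ‖s‖ ^ 2 * t) t := by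
    intro t
    have := (hasDerivAt_pow 2 t).const_mul (L * ‖s‖ ^ 2 / 2)
    refine this.congr_deriv ?_
    norm_num
    ring
  have := image_norm_le_of_norm_deriv_right_le_deriv_boundary (a := 0) (b := 1)
    (fun t _ => (hd t).continuousAt.continuousWithinAt) (fun t _ => (hd t).hasDerivWithinAt)
    (by simp) hB (by
      intro t ht
      rw [← _root_.sub_apply]
      refine (ContinuousLinearMap.le_of_opNorm_le _ (hL _ _) s).trans (le_of_eq ?_)
      rw [add_sub_cancel_left, norm_smul, Real.norm_of_nonneg ht.1]
      ring) (Set.right_mem_Icc.2 zero_le_one)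
  simp only [one_smul, one_pow, mul_one] at this
  linarith

theorem abs_taylor_le {F : E d → ℝ} (hF : ContDiff ℝ 2 F) {L : ℝ}
    (hL : ∀ x y, ‖hess F x - hess F y‖ ≤ L * ‖x - y‖) (x s : E d) :
    |F (x + s) - F x - inner ℝ (gradient F x) s - 1 / 2 * inner ℝ s (hess F x s)| ≤
      L / 6 * ‖s‖ ^ 3 := by
  have hd : ∀ t : ℝ, HasDerivAt (fun t : ℝ => F (x + t • s) - F x - t * inner ℝ (gradient F x) s
      - t ^ 2 * (1 / 2 * inner ℝ s (hess F x s)))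
      (inner ℝ (gradient F (x + t • s) - gradient F x - hess F x (t • s)) s) t := by
    intro t
    have h1 : HasDerivAt (fun t : ℝ => x + t • s) s t := by
      simpa using ((hasDerivAt_id t).smul_const s).const_add x
    have h2 := (hasGradientAt_of_contDiff hF (x + t • s)).hasFDerivAt.comp_hasDerivAt t h1
    have h3 : HasDerivAt (fun t : ℝ => t * inner ℝ (gradient F x) s)
        (1 * inner ℝ (gradient F x) s) t := (hasDerivAt_id t).mul_const _
    have h4 := (hasDerivAt_pow 2 t).mul_const (1 / 2 * inner ℝ s (hess F x s))
    have h5 := ((h2.sub_const (F x)).sub h3).sub h4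
    refine h5.congr_deriv ?_
    rw [map_smul, inner_sub_left, inner_sub_left, real_inner_smul_left, hess_symm hF]
    simp
    ring
  have hB : ∀ t : ℝ, HasDerivAt (fun t : ℝ => L * ‖s‖ ^ 3 / 6 * t ^ 3)
      (L * ‖s‖ ^ 3 / 2 * t ^ 2) t := by
    intro t
    have := (hasDerivAt_pow 3 t).const_mul (L * ‖s‖ ^ 3 / 6)
    refine this.congr_deriv ?_
    norm_num
    ring
  have := image_norm_le_of_norm_deriv_right_le_deriv_boundary (a := 0) (b := 1)
    (fun t _ => (hd t).continuousAt.continuousWithinAt) (fun t _ => (hd t).hasDerivWithinAt)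
    (by simp) hB (by
      intro t ht
      refine (norm_inner_le_norm _ _).trans ?_
      refine (mul_le_mul_of_nonneg_right (norm_gradient_sub_sub_le hF hL x (t • s))
        (norm_nonneg s)).trans (le_of_eq ?_)
      rw [norm_smul, Real.norm_of_nonneg ht.1]
      ring) (Set.right_mem_Icc.2 zero_le_one)
  simp only [one_smul, one_pow, mul_one, one_mul, Real.norm_eq_abs] at this
  linarith

variable {N : ℕ} {f : Fin N → E d → ℝ} {L₀ L₁ L₂ : ℝ≥0}

theorem contDiff_objective (h : StandingAssumption f L₀ L₁ L₂) :
    ContDiff ℝ 2 (objective f) := by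
  unfold objective
  exact contDiff_const.mul (ContDiff.sum fun i _ => h.contDiff i)

theorem gradient_objective (h : StandingAssumption f L₀ L₁ L₂) (x : E d) :
    gradient (objective f) x = (1 / (N : ℝ)) • ∑ i, gradient (f i) x := by
  have h1 : HasFDerivAt (objective f)
      ((1 / (N : ℝ)) • ∑ i, InnerProductSpace.toDual ℝ (E d) (gradient (f i) x)) x := by
    unfold objective
    have := (HasFDerivAt.fun_sum fun i (_ : i ∈ Finset.univ) =>
      (hasGradientAt_of_contDiff (h.contDiff i) x).hasFDerivAt).const_mul (1 / (N : ℝ))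
    exact this
  refine HasGradientAt.gradient ?_
  rw [hasGradientAt_iff_hasFDerivAt]
  simpa using h1

theorem hess_objective (h : StandingAssumption f L₀ L₁ L₂) (x : E d) :
    hess (objective f) x = (1 / (N : ℝ)) • ∑ i, hess (f i) x := by
  have e : gradient (objective f) = fun x => (1 / (N : ℝ)) • ∑ i, gradient (f i) x :=
    funext fun x => gradient_objective h x
  unfold hess
  rw [e]
  exact ((HasFDerivAt.fun_sum fun i (_ : i ∈ Finset.univ) =>
    hasFDerivAt_gradient (h.contDiff i) x).const_smul (1 / (N : ℝ))).fderiv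

theorem norm_hess_sub_le (h : StandingAssumption f L₀ L₁ L₂) (i : Fin N) (x y : E d) :
    ‖hess (f i) x - hess (f i) y‖ ≤ L₂ * ‖x - y‖ := by
  simpa [dist_eq_norm] using (h.lipschitz_hess i).dist_le_mul x y

theorem norm_gradient_sub_le (h : StandingAssumption f L₀ L₁ L₂) (i : Fin N) (x y : E d) :
    ‖gradient (f i) x - gradient (f i) y‖ ≤ L₁ * ‖x - y‖ := by
  simpa [dist_eq_norm] using (h.lipschitz_gradient i).dist_le_mul x y

theorem norm_hess_objective_sub_le (hN : 1 ≤ N) (h : StandingAssumption f L₀ L₁ L₂) (x y : E d) :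
    ‖hess (objective f) x - hess (objective f) y‖ ≤ L₂ * ‖x - y‖ := by
  have hN0 : (0 : ℝ) < N := by exact_mod_cast hN
  have e : hess (objective f) x - hess (objective f) y =
      (1 / (N : ℝ)) • ∑ i, (hess (f i) x - hess (f i) y) := by
    rw [hess_objective h, hess_objective h, Finset.sum_sub_distrib]
    exact (smul_sub _ _ _).symm
  rw [e, norm_smul, Real.norm_of_nonneg (by positivity)]
  calc 1 / (N : ℝ) * ‖∑ i, (hess (f i) x - hess (f i) y)‖
      ≤ 1 / (N : ℝ) * ∑ i : Fin N, L₂ * ‖x - y‖ := by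
        gcongr
        exact (norm_sum_le _ _).trans (Finset.sum_le_sum fun i _ => norm_hess_sub_le h i x y)
    _ = _ := by
        rw [Finset.sum_const, Finset.card_univ, Fintype.card_fin, nsmul_eq_mul]
        field_simp

end Calculus

/-! ### Optimality conditions of the cubic subproblem -/

section CubicModel

variable {d : ℕ} {M : ℝ} {g s : E d} {H : E d →L[ℝ] E d}

theorem cubicModel_stationary (hH : ∀ u v, inner ℝ (H u) v = inner ℝ u (H v))
    (hs : ∀ w, cubicModel M g H s ≤ cubicModel M g H w) :
    g + H s + (M / 2 * ‖s‖) • s = 0 := by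
  have h1 : HasFDerivAt (fun w : E d => ‖w‖ ^ 3) ((3 * ‖s‖) • innerSL ℝ s) s := by
    have := hasFDerivAt_norm_rpow s (p := 3) (by norm_num)
    norm_num at this
    exact_mod_cast this
  have h2 : HasFDerivAt (fun w : E d => inner ℝ g w) (innerSL ℝ g) s :=
    (innerSL ℝ g).hasFDerivAt
  have h3 := (hasFDerivAt_id s).inner ℝ (H.hasFDerivAt (x := s))
  have h4 := (h2.add (h3.const_mul (1 / 2))).add (h1.const_mul (M / 6))
  have h5 : IsLocalMin (fun w => cubicModel M g H w) s := Filter.Eventually.of_forall hs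
  have h6 := h5.hasFDerivAt_eq_zero h4
  rw [← inner_self_eq_zero (𝕜 := ℝ)]
  set v := g + H s + (M / 2 * ‖s‖) • s with hv
  have h7 := congrArg (fun T => T v) h6
  simp [fderivInnerCLM_apply] at h7
  have e : inner ℝ v v = inner ℝ g v + inner ℝ (H s) v + M / 2 * ‖s‖ * inner ℝ s v := by
    nth_rewrite 1 [hv]
    rw [inner_add_left, inner_add_left, real_inner_smul_left]
  rw [e]
  have e2 := hH s v
  have e3 := real_inner_comm v (H s)
  linarith

/-- Reflecting `s` in the hyperplane orthogonal to `v` preserves the norm, so the cubic terms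
cancel; stationarity turns the remaining difference into a positive multiple of the form at `v`.
This needs `⟨v, s⟩ ≠ 0`; the other directions are limits of `v + t s`, or of small multiples of `v`
when `s = 0`. -/
theorem cubicModel_curvature (hH : ∀ u v, inner ℝ (H u) v = inner ℝ u (H v))
    (hs : ∀ w, cubicModel M g H s ≤ cubicModel M g H w) (v : E d) :
    0 ≤ inner ℝ v (H v) + M / 2 * ‖s‖ * ‖v‖ ^ 2 := by
  have hst := cubicModel_stationary hH hs
  have key : ∀ v : E d, inner ℝ v s ≠ 0 → 0 ≤ inner ℝ v (H v) + M / 2 * ‖s‖ * ‖v‖ ^ 2 := by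
    intro v hv
    have hv0 : 0 < ‖v‖ ^ 2 := by
      have : v ≠ 0 := by rintro rfl; simp at hv
      positivity
    set c : ℝ := 2 * inner ℝ v s / ‖v‖ ^ 2 with hc
    have hc0 : c ≠ 0 := by positivity
    have hcv : c * ‖v‖ ^ 2 = 2 * inner ℝ v s := by
      rw [hc, div_mul_cancel₀ _ hv0.ne']
    have hn2 : ‖s - c • v‖ ^ 2 = ‖s‖ ^ 2 := by
      rw [norm_sub_sq_real, norm_smul, mul_pow, Real.norm_eq_abs, sq_abs, real_inner_smul_right,
        real_inner_comm]
      linear_combination c * hcv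
    have hn : ‖s - c • v‖ = ‖s‖ := by
      rwa [sq_eq_sq₀ (norm_nonneg _) (norm_nonneg _)] at hn2
    have h := hs (s - c • v)
    unfold cubicModel at h
    rw [hn] at h
    have hg : inner ℝ g v = -(inner ℝ (H s) v) - M / 2 * ‖s‖ * inner ℝ s v := by
      have := congrArg (fun z => inner ℝ z v) hst
      simp only [inner_add_left, real_inner_smul_left, inner_zero_left] at this
      linarith
    simp only [map_sub, map_smul, inner_sub_left, inner_sub_right, real_inner_smul_left,
      real_inner_smul_right] at h
    have e1 := hH s v
    have e2 := real_inner_comm v (H s)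
    have e3 := real_inner_comm v s
    have : 0 ≤ c ^ 2 * (inner ℝ v (H v) + M / 2 * ‖s‖ * ‖v‖ ^ 2) := by
      rw [hg] at h
      have e4 : M / 2 * ‖s‖ * c * (c * ‖v‖ ^ 2) = M / 2 * ‖s‖ * c * (2 * inner ℝ v s) := by
        rw [hcv]
      rw [e3, e2] at h
      rw [← e1, e2] at h
      nlinarith
    exact nonneg_of_mul_nonneg_right this (by positivity)
  by_cases hs0 : s = 0
  · subst hs0
    have hg : g = 0 := by simpa using hst
    subst hg
    have h1 : ∀ t : ℝ, 0 < t → 0 ≤ inner ℝ v (H v) + t * (M / 3 * ‖v‖ ^ 3) := by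
      intro t ht
      have := hs (t • v)
      simp only [cubicModel, map_smul, real_inner_smul_left, real_inner_smul_right, norm_smul,
        Real.norm_of_nonneg ht.le, inner_zero_left, norm_zero] at this
      have h2 : 0 ≤ t ^ 2 * (inner ℝ v (H v) + t * (M / 3 * ‖v‖ ^ 3)) := by
        norm_num at this
        nlinarith
      exact nonneg_of_mul_nonneg_right h2 (by positivity)
    have h2 : Filter.Tendsto (fun t : ℝ => inner ℝ v (H v) + t * (M / 3 * ‖v‖ ^ 3))
        (nhdsWithin 0 (Set.Ioi 0)) (nhds (inner ℝ v (H v) + 0 * (M / 3 * ‖v‖ ^ 3))) := by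
      refine (Continuous.tendsto ?_ 0).mono_left nhdsWithin_le_nhds
      fun_prop
    have h3 := ge_of_tendsto h2 (eventually_nhdsWithin_of_forall h1)
    simpa using h3
  · by_cases hv : inner ℝ v s = 0
    · have h1 : ∀ t : ℝ, 0 < t → 0 ≤ inner ℝ (v + t • s) (H (v + t • s)) +
          M / 2 * ‖s‖ * ‖v + t • s‖ ^ 2 := by
        intro t ht
        refine key _ ?_
        rw [inner_add_left, hv, real_inner_smul_left, zero_add]
        have : inner ℝ s s ≠ 0 := by simpa using hs0
        positivity
      have h2 : Filter.Tendsto (fun t : ℝ => inner ℝ (v + t • s) (H (v + t • s)) +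
          M / 2 * ‖s‖ * ‖v + t • s‖ ^ 2) (nhdsWithin 0 (Set.Ioi 0))
          (nhds (inner ℝ (v + (0 : ℝ) • s) (H (v + (0 : ℝ) • s)) +
          M / 2 * ‖s‖ * ‖v + (0 : ℝ) • s‖ ^ 2)) := by
        refine (Continuous.tendsto ?_ 0).mono_left nhdsWithin_le_nhds
        fun_prop
      have h3 := ge_of_tendsto h2 (eventually_nhdsWithin_of_forall h1)
      simpa using h3
    · exact key v hv

/-- Stationarity tested against `s` reduces the model to `-½⟨s, H s⟩ - (M/3)‖s‖³`, and curvature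
along `s` bounds the first term by `(M/4)‖s‖³`. -/
theorem cubicModel_le (hH : ∀ u v, inner ℝ (H u) v = inner ℝ u (H v))
    (hs : ∀ w, cubicModel M g H s ≤ cubicModel M g H w) :
    cubicModel M g H s ≤ -(M / 12 * ‖s‖ ^ 3) := by
  have h1 := congrArg (fun z => inner ℝ z s) (cubicModel_stationary hH hs)
  have h2 := cubicModel_curvature hH hs s
  simp only [inner_add_left, real_inner_smul_left, inner_zero_left,
    real_inner_self_eq_norm_sq] at h1
  unfold cubicModel
  have e2 := hH s s
  nlinarith

end CubicModel

/-! ### One step with accurate estimators -/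

section Step

variable {d : ℕ}

/-- The guaranteed model decrease `M/12` and the cubic term `M/6` add up to `M/4`, from which
Taylor's remainder takes `L/6`. The last two terms are the estimator errors. -/
theorem objective_step_le {F : E d → ℝ} (hF : ContDiff ℝ 2 F) {L M α β R : ℝ}
    (hL : ∀ x y, ‖hess F x - hess F y‖ ≤ L * ‖x - y‖) {x g s : E d} {H : E d →L[ℝ] E d}
    (hH : ∀ u v, inner ℝ (H u) v = inner ℝ u (H v))
    (hs : ∀ w, cubicModel M g H s ≤ cubicModel M g H w)
    (hg : ‖g - gradient F x‖ ≤ β * R ^ 2) (hHx : ‖H - hess F x‖ ≤ α * R) :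
    F (x + s) ≤ F x - (3 * M - 2 * L) / 12 * ‖s‖ ^ 3 + β * R ^ 2 * ‖s‖
      + α / 2 * R * ‖s‖ ^ 2 := by
  have h1 := (abs_le.1 (abs_taylor_le hF hL x s)).2
  have h2 := cubicModel_le hH hs
  unfold cubicModel at h2
  have h3 : -(β * R ^ 2 * ‖s‖) ≤ inner ℝ (g - gradient F x) s := by
    have := (abs_le.1 (abs_real_inner_le_norm (g - gradient F x) s)).1
    nlinarith [norm_nonneg s]
  have h4 : -(α * R * ‖s‖ ^ 2) ≤ inner ℝ s ((H - hess F x) s) := by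
    have i1 := (abs_le.1 (abs_real_inner_le_norm s ((H - hess F x) s))).1
    have i2 := (H - hess F x).le_of_opNorm_le hHx s
    nlinarith [norm_nonneg s]
  rw [inner_sub_left] at h3
  rw [_root_.sub_apply, inner_sub_right] at h4
  linarith

theorem norm_gradient_step_le {F : E d → ℝ} (hF : ContDiff ℝ 2 F) {L M α β R : ℝ} (hM : 0 ≤ M)
    (hL : ∀ x y, ‖hess F x - hess F y‖ ≤ L * ‖x - y‖) {x g s : E d} {H : E d →L[ℝ] E d}
    (hH : ∀ u v, inner ℝ (H u) v = inner ℝ u (H v))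
    (hs : ∀ w, cubicModel M g H s ≤ cubicModel M g H w)
    (hg : ‖g - gradient F x‖ ≤ β * R ^ 2) (hHx : ‖H - hess F x‖ ≤ α * R) :
    ‖gradient F (x + s)‖ ≤ (L + M) / 2 * ‖s‖ ^ 2 + β * R ^ 2 + α * R * ‖s‖ := by
  have h1 := norm_gradient_sub_sub_le hF hL x s
  have h2 := (H - hess F x).le_of_opNorm_le hHx s
  have h3 := cubicModel_stationary hH hs
  have h4 : ‖(M / 2 * ‖s‖) • s‖ = M / 2 * ‖s‖ ^ 2 := by
    rw [norm_smul, Real.norm_of_nonneg (by positivity)]; ring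
  have e : gradient F (x + s) = (gradient F (x + s) - gradient F x - hess F x s)
      - (g - gradient F x) - (H - hess F x) s - (M / 2 * ‖s‖) • s := by
    rw [eq_comm, ← sub_eq_zero, ← neg_eq_zero, ← h3, _root_.sub_apply]
    abel
  rw [e]
  have t1 := norm_sub_le (gradient F (x + s) - gradient F x - hess F x s
      - (g - gradient F x) - (H - hess F x) s) ((M / 2 * ‖s‖) • s)
  have t2 := norm_sub_le (gradient F (x + s) - gradient F x - hess F x s
      - (g - gradient F x)) ((H - hess F x) s)
  have t3 := norm_sub_le (gradient F (x + s) - gradient F x - hess F x s) (g - gradient F x)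
  linarith

theorem quadForm_hess_step_ge {F : E d → ℝ} {L M α R : ℝ}
    (hL : ∀ x y, ‖hess F x - hess F y‖ ≤ L * ‖x - y‖) {x g s : E d} {H : E d →L[ℝ] E d}
    (hH : ∀ u v, inner ℝ (H u) v = inner ℝ u (H v))
    (hs : ∀ w, cubicModel M g H s ≤ cubicModel M g H w)
    (hHx : ‖H - hess F x‖ ≤ α * R) (v : E d) :
    -((M + 2 * L) / 2 * ‖s‖ + α * R) * ‖v‖ ^ 2 ≤ inner ℝ v (hess F (x + s) v) := by
  have h1 := cubicModel_curvature hH hs v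
  have h2 : inner ℝ v ((H - hess F x) v) ≤ α * R * ‖v‖ ^ 2 := by
    have i1 := (abs_le.1 (abs_real_inner_le_norm v ((H - hess F x) v))).2
    have i2 := (H - hess F x).le_of_opNorm_le hHx v
    nlinarith [norm_nonneg v]
  have h3 : -(L * ‖s‖ * ‖v‖ ^ 2) ≤ inner ℝ v ((hess F (x + s) - hess F x) v) := by
    have i1 := (abs_le.1 (abs_real_inner_le_norm v ((hess F (x + s) - hess F x) v))).1
    have i0 := hL (x + s) x
    rw [add_sub_cancel_left] at i0
    have i2 := (hess F (x + s) - hess F x).le_of_opNorm_le i0 v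
    nlinarith [norm_nonneg v]
  rw [_root_.sub_apply, inner_sub_right] at h2 h3
  linarith

end Step

/-! ### Potential function and cost accounting -/

section Invariant

variable {d N : ℕ}

/-- Energy part of the invariant after `k` iterations without termination; `P` is the sum of the
cubes of the step norms. -/
structure Energy (p : Params) (f : Fin N → E d → ℝ) (x₀ : E d) (k : ℕ) (x : E d) (r P : ℝ) :
    Prop where
  nonneg : 0 ≤ r
  descent : objective f x + (2 * p.β + p.α) * r ^ 3 + 2 * gammaConst p.L₂ p.M p.α p.β * P ≤
    objective f x₀ + (2 * p.β + p.α) * p.ε₁ ^ 3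
  progress : k * p.ε₁ ^ 3 ≤ 2 * P - r ^ 3 + p.ε₁ ^ 3

/-- Bookkeeping part of the invariant: `q` epochs have been started, `j` steps were made in the
current one, and `A`, `a` are the sums of `1 + (‖s‖/ε₁)³` over the steps in the finished epochs
and the current one. -/
def CostBound (p : Params) (N : ℕ) (c₂ : ℝ) (k : ℕ) (x xref : E d) (cost : ℕ) (P : ℝ) : Prop :=
  ∃ (q j : ℕ) (A a : ℝ), 0 ≤ A ∧ 0 ≤ a ∧ 1 ≤ j ∧ j ≤ p.m ∧ p.m * q + j = k + p.m ∧
    ‖x - xref‖ ^ 2 ≤ p.ε₁ ^ 2 * j * a ∧ A + a ≤ k + P / p.ε₁ ^ 3 ∧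
    (cost : ℝ) ≤ N * q + k + c₂ * p.m * (p.m * A + j * a)

/-- The invariant of the algorithm. -/
def Invariant (p : Params) (f : Fin N → E d → ℝ) (x₀ : E d) (c₂ ε B : ℝ) (k : ℕ) :
    State d → Prop
  | State.done y cost => IsApproxSOSP (objective f) ε y ∧ (cost : ℝ) ≤ B
  | State.running x xref r cost =>
      ∃ P, Energy p f x₀ k x r P ∧ CostBound p N c₂ k x xref cost P

variable {p : Params} {f : Fin N → E d → ℝ} {x₀ : E d} {c₂ : ℝ} {k : ℕ} {x xref : E d}
  {cost : ℕ} {P : ℝ}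

theorem costBound_zero (hm : 1 ≤ p.m) : CostBound p N c₂ 0 x₀ x₀ 0 0 :=
  -- Before iteration `0` a fictitious full epoch (`j = m`, `q = 0`) has just ended, so the first
  -- reset needs no separate case.
  ⟨0, p.m, 0, 0, le_rfl, le_rfl, hm, le_rfl, by simp, by simp, by simp, by simp⟩

/-- Batch sizes involve squared displacements while the potential controls cubes; the `1` is paid
for by the iteration count. -/
theorem sq_le_one_add_cube {t : ℝ} (ht : 0 ≤ t) : t ^ 2 ≤ 1 + t ^ 3 := by
  nlinarith [mul_nonneg ht (sq_nonneg (t - 1)), sq_nonneg (t - 1)]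

theorem CostBound.reset (h : CostBound p N c₂ k x xref cost P) (hk : k % p.m = 0)
    (hε : 0 < p.ε₁) (hc : 0 ≤ c₂) (s : E d) :
    CostBound p N c₂ (k + 1) (x + s) x (cost + N) (P + ‖s‖ ^ 3) := by
  obtain ⟨q, j, A, a, hA, ha, hj1, hjm, hqj, hx, hAa, hcost⟩ := h
  have hjeq : j = p.m := by
    have h1 : p.m ∣ k := Nat.dvd_of_mod_eq_zero hk
    have h2 : p.m ∣ p.m * q + j := hqj ▸ h1.add (dvd_refl _)
    exact le_antisymm hjm (Nat.le_of_dvd hj1 ((Nat.dvd_add_right (dvd_mul_right _ _)).1 h2))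
  have hq : p.m * q = k := by omega
  set t := ‖s‖ / p.ε₁ with ht
  have ht0 : 0 ≤ t := by positivity
  have hst : ‖s‖ = p.ε₁ * t := by rw [ht]; field_simp
  have hm1 : (1 : ℝ) ≤ p.m := by exact_mod_cast hj1.trans hjm
  refine ⟨q + 1, 1, A + a, 1 + t ^ 3, by positivity, by positivity, le_rfl, hj1.trans hjm, ?_,
    ?_, ?_, ?_⟩
  · rw [mul_add, hq]; ring
  · rw [add_sub_cancel_left, hst, mul_pow, Nat.cast_one, mul_one]
    exact mul_le_mul_of_nonneg_left (sq_le_one_add_cube ht0) (by positivity)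
  · rw [add_div, ht, div_pow]; push_cast; linarith
  · rw [hjeq] at hcost
    push_cast
    have : 0 ≤ c₂ * p.m * (1 + t ^ 3) := by positivity
    nlinarith

theorem CostBound.step (h : CostBound p N c₂ k x xref cost P) (hk : k % p.m ≠ 0)
    (hε : 0 < p.ε₁) (hc : 0 ≤ c₂) (s : E d) {n : ℕ}
    (hn : (n : ℝ) ≤ 1 + c₂ * (‖x - xref‖ ^ 2 / p.ε₁ ^ 2)) :
    CostBound p N c₂ (k + 1) (x + s) xref (cost + n) (P + ‖s‖ ^ 3) := by
  obtain ⟨q, j, A, a, hA, ha, hj1, hjm, hqj, hx, hAa, hcost⟩ := h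
  have hjlt : j < p.m := by
    refine lt_of_le_of_ne hjm fun e => hk ?_
    have : k = p.m * q := by omega
    rw [this, Nat.mul_mod_right]
  set t := ‖s‖ / p.ε₁ with ht
  have ht0 : 0 ≤ t := by positivity
  have hst : ‖s‖ = p.ε₁ * t := by rw [ht]; field_simp
  have hj0 : (1 : ℝ) ≤ j := by exact_mod_cast hj1
  have hjm' : (j : ℝ) ≤ p.m := by exact_mod_cast hjm
  have hsq := sq_le_one_add_cube ht0
  refine ⟨q, j + 1, A, a + (1 + t ^ 3), hA, by positivity, by omega, hjlt, by omega, ?_, ?_, ?_⟩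
  · have h1 : ‖x + s - xref‖ ≤ ‖x - xref‖ + ‖s‖ := by
      rw [add_sub_right_comm]; exact norm_add_le _ _
    have h2 : ‖x + s - xref‖ ^ 2 ≤ (‖x - xref‖ + ‖s‖) ^ 2 :=
      pow_le_pow_left₀ (norm_nonneg _) h1 2
    set y := ‖x - xref‖ with hy
    -- Incremental form of Cauchy-Schwarz; the difference of the two sides is `(y - j‖s‖)²`.
    have h3 : j * (y + ‖s‖) ^ 2 ≤ (j + 1) * (y ^ 2 + j * ‖s‖ ^ 2) := by
      nlinarith [sq_nonneg (y - j * ‖s‖)]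
    have h4 : y ^ 2 + j * ‖s‖ ^ 2 ≤ j * (p.ε₁ ^ 2 * (a + (1 + t ^ 3))) := by
      have : j * ‖s‖ ^ 2 ≤ j * (p.ε₁ ^ 2 * (1 + t ^ 3)) := by
        rw [hst, mul_pow]; gcongr
      nlinarith
    have h5 : j * (y + ‖s‖) ^ 2 ≤ j * ((j + 1) * (p.ε₁ ^ 2 * (a + (1 + t ^ 3)))) := by
      refine h3.trans ((mul_le_mul_of_nonneg_left h4 (by positivity)).trans (le_of_eq ?_))
      ring
    have h6 := le_of_mul_le_mul_left h5 (by linarith)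
    push_cast
    linarith
  · rw [add_div, ht, div_pow]; push_cast; linarith
  · have h1 : ‖x - xref‖ ^ 2 / p.ε₁ ^ 2 ≤ j * a := by
      rw [div_le_iff₀ (by positivity)]; linarith
    have h2 : c₂ * (‖x - xref‖ ^ 2 / p.ε₁ ^ 2) ≤ c₂ * (p.m * a) := by
      refine mul_le_mul_of_nonneg_left (h1.trans ?_) hc
      gcongr
    have h3 : c₂ * p.m * (p.m * A + j * a) + c₂ * (p.m * a) ≤
        c₂ * p.m * (p.m * A + (j + 1) * (a + (1 + t ^ 3))) := by
      have : 0 ≤ c₂ * p.m * ((j + 1) * (1 + t ^ 3)) := by positivity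
      nlinarith
    push_cast
    linarith

/-- The bound on the total number of Hessian samples when at most `K` iterations are made. -/
noncomputable def totalCost (N m : ℕ) (c₂ K : ℝ) : ℝ :=
  N + N * K / m + (K + 1) + 4 * c₂ * m ^ 2 * K

theorem CostBound.le_totalCost (h : CostBound p N c₂ (k + 1) x xref cost P) (hc : 0 ≤ c₂)
    {K : ℝ} (hK : 1 ≤ K) (hkK : k ≤ K) (hP : P / p.ε₁ ^ 3 ≤ K / 2 + 1) :
    (cost : ℝ) ≤ totalCost N p.m c₂ K := by
  obtain ⟨q, j, A, a, hA, ha, hj1, hjm, hqj, hx, hAa, hcost⟩ := h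
  have hm1 : (1 : ℝ) ≤ p.m := by exact_mod_cast hj1.trans hjm
  have hjm' : (j : ℝ) ≤ p.m := by exact_mod_cast hjm
  have hj1' : (1 : ℝ) ≤ j := by exact_mod_cast hj1
  have hqj' : (p.m : ℝ) * q + j = k + 1 + p.m := by exact_mod_cast hqj
  have h1 : (N : ℝ) * q ≤ N + N * K / p.m := by
    have : (q : ℝ) ≤ 1 + K / p.m := by
      rw [← sub_le_iff_le_add', le_div_iff₀ (by linarith)]
      linarith
    calc (N : ℝ) * q ≤ N * (1 + K / p.m) := by gcongr
      _ = _ := by ring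
  have h2 : c₂ * p.m * (p.m * A + j * a) ≤ 4 * c₂ * p.m ^ 2 * K := by
    push_cast at hAa
    calc c₂ * p.m * (p.m * A + j * a) ≤ c₂ * p.m * (p.m * A + p.m * a) := by gcongr
      _ = c₂ * p.m ^ 2 * (A + a) := by ring
      _ ≤ c₂ * p.m ^ 2 * (4 * K) := by
        gcongr
        linarith
      _ = _ := by ring
  unfold totalCost
  push_cast at hcost
  linarith

/-- Descent and the lower bound on `F` give `2P < K ε₁³`; `progress` then leaves only `k < K + 1`.
-/
theorem Energy.bounds {Δ r : ℝ} (h : Energy p f x₀ k x r P) (hbdd : BddBelow (Set.range (objective f)))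
    (hΔ : objective f x₀ - (⨅ x, objective f x) ≤ Δ) (hε : 0 < p.ε₁) (hα : 0 < p.α) (hβ : 0 < p.β)
    (hγ : 0 < gammaConst p.L₂ p.M p.α p.β) :
    k ≤ iterBound p.L₂ p.M p.α p.β Δ p.ε₁ ∧
      P / p.ε₁ ^ 3 ≤ (iterBound p.L₂ p.M p.α p.β Δ p.ε₁ : ℝ) / 2 := by
  have hinf := ciInf_le hbdd x
  have hr : 0 ≤ r ^ 3 := pow_nonneg h.nonneg 3
  have he : 0 < p.ε₁ ^ 3 := by positivity
  have hd := h.descent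
  have hp := h.progress
  set γ := gammaConst p.L₂ p.M p.α p.β
  set K := iterBound p.L₂ p.M p.α p.β Δ p.ε₁ with hK
  have hlt : (Δ + (2 * p.β + p.α) * p.ε₁ ^ 3) / (γ * p.ε₁ ^ 3) < K := by
    rw [hK]; unfold iterBound; push_cast; exact Nat.lt_floor_add_one _
  rw [div_lt_iff₀ (by positivity)] at hlt
  have h1 : 2 * γ * P ≤ Δ + (2 * p.β + p.α) * p.ε₁ ^ 3 := by
    have : 0 ≤ (2 * p.β + p.α) * r ^ 3 := by positivity
    linarith
  have h2 : 2 * P < K * p.ε₁ ^ 3 := by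
    have : γ * (2 * P) < γ * (K * p.ε₁ ^ 3) := by linarith
    exact lt_of_mul_lt_mul_left this hγ.le
  constructor
  · have h3 : (k : ℝ) * p.ε₁ ^ 3 < (K + 1 : ℝ) * p.ε₁ ^ 3 := by linarith
    have h4 := lt_of_mul_lt_mul_right h3 he.le
    have h5 : k < K + 1 := by exact_mod_cast h4
    omega
  · rw [div_le_iff₀ he]
    linarith

theorem sq_mul_le_cube_add_cube {u v : ℝ} (hu : 0 ≤ u) (hv : 0 ≤ v) :
    u ^ 2 * v ≤ u ^ 3 + v ^ 3 := by
  nlinarith [mul_nonneg (add_nonneg hu hv) (sq_nonneg (u - v)), mul_nonneg hu (sq_nonneg v)]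

/-- Young's inequality bounds the estimator errors by `(β + α/2)(R³ + ‖s‖³)`, hence by `(2β + α)(r³
+ ‖s‖³)`. The potential absorbs the `r³` part, and the definition of `γ` leaves a surplus `(β +
α/2)‖s‖³`. -/
theorem Energy.step {r : ℝ} (h : Energy p f x₀ k x r P) (hε : 0 < p.ε₁) (hα : 0 < p.α)
    (hβ : 0 < p.β) {s : E d} (hns : ¬ max ‖s‖ r ≤ p.ε₁)
    (hstep : objective f (x + s) ≤ objective f x - (3 * p.M - 2 * p.L₂) / 12 * ‖s‖ ^ 3
      + p.β * (max r p.ε₁) ^ 2 * ‖s‖ + p.α / 2 * (max r p.ε₁) * ‖s‖ ^ 2) :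
    Energy p f x₀ (k + 1) (x + s) ‖s‖ (P + ‖s‖ ^ 3) := by
  have hr := h.nonneg
  have hs := norm_nonneg s
  have hp := h.progress
  have hd := h.descent
  have hr3 : 0 ≤ r ^ 3 := by positivity
  have hs3 : 0 ≤ ‖s‖ ^ 3 := by positivity
  have hpos : p.ε₁ ^ 3 ≤ ‖s‖ ^ 3 + r ^ 3 := by
    rw [max_le_iff, not_and_or, not_le, not_le] at hns
    rcases hns with h1 | h1
    · have := pow_le_pow_left₀ hε.le h1.le 3; linarith
    · have := pow_le_pow_left₀ hε.le h1.le 3; linarith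
  set R := max r p.ε₁ with hR
  have hR0 : 0 ≤ R := le_max_of_le_left hr
  -- If `R = ε₁`, the failed stopping test supplies the bound.
  have hR3 : R ^ 3 ≤ 2 * r ^ 3 + ‖s‖ ^ 3 := by
    rcases max_choice r p.ε₁ with e | e
    · rw [hR, e]; linarith
    · rw [hR, e]; linarith
  have a1 : p.β * R ^ 2 * ‖s‖ ≤ p.β * (R ^ 3 + ‖s‖ ^ 3) := by
    rw [mul_assoc]; exact mul_le_mul_of_nonneg_left (sq_mul_le_cube_add_cube hR0 hs) hβ.le
  have a2 : p.α / 2 * R * ‖s‖ ^ 2 ≤ p.α / 2 * (R ^ 3 + ‖s‖ ^ 3) := by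
    rw [mul_assoc]
    refine mul_le_mul_of_nonneg_left ?_ (by positivity)
    have := sq_mul_le_cube_add_cube hs hR0
    linarith
  have a3 : p.β * R ^ 3 ≤ p.β * (2 * r ^ 3 + ‖s‖ ^ 3) := mul_le_mul_of_nonneg_left hR3 hβ.le
  have a4 : p.α * R ^ 3 ≤ p.α * (2 * r ^ 3 + ‖s‖ ^ 3) := mul_le_mul_of_nonneg_left hR3 hα.le
  refine ⟨hs, ?_, ?_⟩
  · unfold gammaConst at hd ⊢
    have b1 : 0 ≤ p.β * ‖s‖ ^ 3 := by positivity
    have b2 : 0 ≤ p.α * ‖s‖ ^ 3 := by positivity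
    nlinarith
  · push_cast
    linarith

theorem invariant_advance (hN : 1 ≤ N) {L₀ L₁ L₂ : ℝ≥0} (hf : StandingAssumption f L₀ L₁ L₂)
    (hL₂ : p.L₂ = L₂) {Δ ε r : ℝ} (hΔ : objective f x₀ - (⨅ x, objective f x) ≤ Δ)
    (hε : 0 < p.ε₁) (hα : 0 < p.α) (hβ : 0 < p.β) (hM : 0 ≤ p.M)
    (hγ : 0 < gammaConst p.L₂ p.M p.α p.β) (hc : 0 ≤ c₂)
    (hτ₁ : ((p.L₂ + p.M) / 2 + 2 * p.β + 2 * p.α) * p.ε₁ ^ 2 ≤ ε)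
    (hτ₂ : ((p.M + 2 * p.L₂) / 2 + 2 * p.α) * p.ε₁ ≤ Real.sqrt ε)
    {solve : E d → (E d →L[ℝ] E d) → E d} (hsolve : IsCubicSolver p.M solve)
    {g : E d} {H : E d →L[ℝ] E d} (hH : ∀ u v, inner ℝ (H u) v = inner ℝ u (H v))
    (hg : ‖g - gradient (objective f) x‖ ≤ p.β * (max r p.ε₁) ^ 2)
    (hHx : ‖H - hess (objective f) x‖ ≤ p.α * max r p.ε₁)
    (hE : Energy p f x₀ k x r P)
    (hC : CostBound p N c₂ (k + 1) (x + solve g H) xref cost (P + ‖solve g H‖ ^ 3)) :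
    Invariant p f x₀ c₂ ε
      (totalCost N p.m c₂ (iterBound p.L₂ p.M p.α p.β Δ p.ε₁)) (k + 1)
      (advance p solve x xref r cost g H) := by
  have hF := contDiff_objective hf
  have hLip : ∀ x y, ‖hess (objective f) x - hess (objective f) y‖ ≤ p.L₂ * ‖x - y‖ := by
    rw [hL₂]; exact norm_hess_objective_sub_le hN hf
  have hs := hsolve g H hH
  set s := solve g H with hsdef
  have hL0 : 0 ≤ p.L₂ := by rw [hL₂]; exact L₂.2
  unfold advance
  split_ifs with hsmall
  · rw [← hsdef] at hsmall
    obtain ⟨hs1, hr1⟩ := max_le_iff.1 hsmall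
    have hR : max r p.ε₁ = p.ε₁ := max_eq_right hr1
    have hg2 := norm_gradient_step_le hF hM hLip hH hs hg hHx
    have hh2 := quadForm_hess_step_ge hLip hH hs hHx
    rw [hR] at hg2 hh2
    have hs2 : ‖s‖ ^ 2 ≤ p.ε₁ ^ 2 := pow_le_pow_left₀ (norm_nonneg _) hs1 2
    have hs3 : ‖s‖ ^ 3 ≤ p.ε₁ ^ 3 := pow_le_pow_left₀ (norm_nonneg _) hs1 3
    refine ⟨⟨?_, ?_⟩, ?_⟩
    · refine hg2.trans (le_trans ?_ hτ₁)
      have a1 : (p.L₂ + p.M) / 2 * ‖s‖ ^ 2 ≤ (p.L₂ + p.M) / 2 * p.ε₁ ^ 2 := by gcongr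
      have a2 : p.α * p.ε₁ * ‖s‖ ≤ p.α * p.ε₁ * p.ε₁ := by gcongr
      have a3 : 0 ≤ p.β * p.ε₁ ^ 2 := by positivity
      have a4 : 0 ≤ p.α * p.ε₁ ^ 2 := by positivity
      nlinarith
    · intro v
      refine le_trans ?_ (hh2 v)
      refine mul_le_mul_of_nonneg_right ?_ (sq_nonneg _)
      have a1 : (p.M + 2 * p.L₂) / 2 * ‖s‖ ≤ (p.M + 2 * p.L₂) / 2 * p.ε₁ := by gcongr
      have a4 : 0 ≤ p.α * p.ε₁ := by positivity
      nlinarith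
    -- The energy is known only before the final step; that step has norm at most `ε₁` and adds at
    -- most `1` to `P / ε₁³`.
    · obtain ⟨hk, hP⟩ := hE.bounds hf.bddBelow hΔ hε hα hβ hγ
      refine hC.le_totalCost hc ?_ (by exact_mod_cast hk) ?_
      · unfold iterBound; push_cast; linarith [Nat.cast_nonneg (α := ℝ)
          ⌊(Δ + (2 * p.β + p.α) * p.ε₁ ^ 3) / (gammaConst p.L₂ p.M p.α p.β * p.ε₁ ^ 3)⌋₊]
      · rw [add_div]
        refine add_le_add hP ?_
        rw [div_le_one (by positivity)]
        exact hs3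
  · exact ⟨_, hE.step hε hα hβ hsmall (objective_step_le hF hLip hH hs hg hHx), hC⟩

end Invariant

/-! ### Union bound along the run -/

section Probability

theorem outer_univ {α : Type*} (q : PMF α) : q.toOuterMeasure Set.univ = 1 := by
  rw [PMF.toOuterMeasure_apply_eq_one_iff]; exact Set.subset_univ _

theorem outer_le_one {α : Type*} (q : PMF α) (S : Set α) : q.toOuterMeasure S ≤ 1 :=
  (MeasureTheory.measure_mono (Set.subset_univ S)).trans (outer_univ q).le

/-- Union bound for a composed experiment: `T` collects the bad first outcomes, and `b` bounds
failure after a good one. -/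
theorem bind_outer_le {α β : Type*} (q : PMF α) (F : α → PMF β) (S : Set β) (T : Set α)
    {b : ℝ≥0∞} (h : ∀ a ∈ q.support, a ∉ T → (F a).toOuterMeasure S ≤ b) :
    (q.bind F).toOuterMeasure S ≤ q.toOuterMeasure T + b := by
  classical
  rw [PMF.toOuterMeasure_bind_apply, PMF.toOuterMeasure_apply]
  have h1 : ∀ a, q a * (F a).toOuterMeasure S ≤ T.indicator q a + q a * b := by
    intro a
    by_cases ha : a ∈ T
    · rw [Set.indicator_of_mem ha]
      refine le_add_right (mul_le_of_le_one_right' ?_)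
      exact outer_le_one (F a) S
    · rw [Set.indicator_of_notMem ha, zero_add]
      by_cases hs : a ∈ q.support
      · gcongr
        exact h a hs ha
      · rw [PMF.mem_support_iff, not_not] at hs
        simp [hs]
  refine (ENNReal.tsum_le_tsum h1).trans ?_
  rw [ENNReal.tsum_add, ENNReal.tsum_mul_right, q.tsum_coe, one_mul]

variable {d N : ℕ} {p : Params} {f : Fin N → E d → ℝ} {x₀ : E d} {c₂ : ℝ} {k : ℕ}

theorem max_pow_eq {a b : ℝ} (ha : 0 ≤ a) (hb : 0 ≤ b) (n : ℕ) :
    max (a ^ n) (b ^ n) = (max a b) ^ n := by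
  rcases le_total a b with h | h
  · rw [max_eq_right h, max_eq_right (pow_le_pow_left₀ ha h n)]
  · rw [max_eq_left h, max_eq_left (pow_le_pow_left₀ hb h n)]

theorem gradEst_outer_le (hN : 1 ≤ N) {L₀ L₁ L₂ : ℝ≥0} (hf : StandingAssumption f L₀ L₁ L₂)
    (hL₁ : p.L₁ = L₁) (hε : 0 < p.ε₁) (hβ : 0 < p.β) (hζ : 0 < p.ζ) (hζ1 : p.ζ ≤ 1)
    (x xref : E d) {r : ℝ} (hr : 0 ≤ r) :
    (sampleSubset N (gradBatch p N x xref r)).toOuterMeasure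
      {ξ | ¬ ‖gradEst f x xref ξ - gradient (objective f) x‖ ≤ p.β * (max r p.ε₁) ^ 2} ≤
      ENNReal.ofReal (p.ζ / 2) := by
  have hR : 0 < max r p.ε₁ := lt_max_of_lt_right hε
  have harg : 1 ≤ 2 * ((d : ℝ) + 1) / p.ζ := by
    rw [le_div_iff₀ hζ]; nlinarith [Nat.cast_nonneg (α := ℝ) d]
  have h := sampleSubset_norm_le hN (fun i => gradient (f i) x - gradient (f i) xref)
    (b := p.L₁ * ‖x - xref‖) (ℓ := Real.log (2 * ((d : ℝ) + 1) / p.ζ))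
    (t := p.β * (max r p.ε₁) ^ 2)
    (fun i => by rw [hL₁]; exact norm_gradient_sub_le hf i x xref) (by positivity)
    (Real.log_nonneg harg)
  have e1 : gradBatch p N x xref r = batchSize N ((p.β * (max r p.ε₁) ^ 2) ^ 2)
      (64 * (p.L₁ * ‖x - xref‖) ^ 2 * Real.log (2 * ((d : ℝ) + 1) / p.ζ)) := by
    unfold gradBatch
    rw [max_pow_eq hr hε.le]
    congr 1 <;> ring
  -- The logarithm in the batch size is calibrated to cancel the dimension factor, so the gradient
  -- takes half of `ζ`; the Hessian, with factor `2d`, takes the other half.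
  have e2 : ((Module.finrank ℝ (E d) : ℝ) + 1) * Real.exp (-Real.log (2 * ((d : ℝ) + 1) / p.ζ)) =
      p.ζ / 2 := by
    rw [Real.exp_neg, Real.exp_log (by linarith), finrank_euclideanSpace_fin]
    field_simp
  rw [e2, ← e1] at h
  refine le_trans (le_of_eq ?_) h
  congr 1
  ext ξ
  have e3 : gradEst f x xref ξ - gradient (objective f) x =
      (1 / (ξ.card : ℝ)) • ∑ k ∈ ξ, (gradient (f k) x - gradient (f k) xref) -
        (1 / (N : ℝ)) • ∑ k, (gradient (f k) x - gradient (f k) xref) := by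
    unfold gradEst
    rw [gradient_objective hf, gradient_objective hf, Finset.sum_sub_distrib (s := Finset.univ),
      smul_sub (1 / (N : ℝ))]
    abel
  rw [Set.mem_ofPred_eq, Set.mem_ofPred_eq, e3]

theorem hessEst_outer_le (hd : 1 ≤ d) (hN : 1 ≤ N) {L₀ L₁ L₂ : ℝ≥0}
    (hf : StandingAssumption f L₀ L₁ L₂)
    (hL₂ : p.L₂ = L₂) (hε : 0 < p.ε₁) (hα : 0 < p.α) (hζ : 0 < p.ζ) (hζ1 : p.ζ ≤ 1)
    (x xref : E d) {r : ℝ} (hr : 0 ≤ r) :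
    (sampleSubset N (hessBatch p N x xref r)).toOuterMeasure
      {ξ | ¬ ‖hessEst f x xref ξ - hess (objective f) x‖ ≤ p.α * max r p.ε₁} ≤
      ENNReal.ofReal (p.ζ / 2) := by
  have hR : 0 < max r p.ε₁ := lt_max_of_lt_right hε
  have hd' : (1 : ℝ) ≤ d := by exact_mod_cast hd
  have harg : 1 ≤ 4 * (d : ℝ) / p.ζ := by
    rw [le_div_iff₀ hζ]; linarith
  have h := sampleSubset_opNorm_le hN (fun i => hess (f i) x - hess (f i) xref)
    (by
      intro i u v
      rw [_root_.sub_apply, _root_.sub_apply, inner_sub_left, inner_sub_right,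
        hess_symm (hf.contDiff i), hess_symm (hf.contDiff i)])
    (b := p.L₂ * ‖x - xref‖) (ℓ := Real.log (4 * (d : ℝ) / p.ζ)) (t := p.α * max r p.ε₁)
    (fun i => by rw [hL₂]; exact norm_hess_sub_le hf i x xref) (by positivity)
    (Real.log_nonneg harg)
  have e1 : hessBatch p N x xref r = batchSize N ((p.α * max r p.ε₁) ^ 2)
      (64 * (p.L₂ * ‖x - xref‖) ^ 2 * Real.log (4 * (d : ℝ) / p.ζ)) := by
    unfold hessBatch
    rw [max_pow_eq hr hε.le]
    congr 1 <;> ring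
  have e2 : 2 * ((Module.finrank ℝ (E d) : ℝ) * Real.exp (-Real.log (4 * (d : ℝ) / p.ζ))) =
      p.ζ / 2 := by
    rw [Real.exp_neg, Real.exp_log (by linarith), finrank_euclideanSpace_fin]
    field_simp
    norm_num
  rw [e2, ← e1] at h
  refine le_trans (le_of_eq ?_) h
  congr 1
  ext ξ
  have e3 : hessEst f x xref ξ - hess (objective f) x =
      (1 / (ξ.card : ℝ)) • ∑ k ∈ ξ, (hess (f k) x - hess (f k) xref) -
        (1 / (N : ℝ)) • ∑ k, (hess (f k) x - hess (f k) xref) := by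
    unfold hessEst
    rw [hess_objective hf, hess_objective hf, Finset.sum_sub_distrib (s := Finset.univ)]
    have := smul_sub (1 / (N : ℝ)) (∑ i, hess (f i) x) (∑ i, hess (f i) xref)
    rw [this]
    abel
  rw [Set.mem_ofPred_eq, Set.mem_ofPred_eq, e3]

theorem hessEst_symm {L₀ L₁ L₂ : ℝ≥0} (hf : StandingAssumption f L₀ L₁ L₂) (x xref : E d)
    (ξ : Finset (Fin N)) (u v : E d) :
    inner ℝ (hessEst f x xref ξ u) v = inner ℝ u (hessEst f x xref ξ v) := by
  unfold hessEst
  simp only [_root_.add_apply, _root_.smul_apply, _root_.sum_apply, _root_.sub_apply,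
    inner_add_left, inner_add_right, real_inner_smul_left, real_inner_smul_right, sum_inner,
    inner_sum, inner_sub_left, inner_sub_right, hess_symm (hf.contDiff _),
    hess_symm (contDiff_objective hf)]

theorem hessBatch_le (hd : 1 ≤ d) (hN : 1 ≤ N) (hε : 0 < p.ε₁) (hα : 0 < p.α) (hζ : 0 < p.ζ)
    (hζ1 : p.ζ ≤ 1) (x xref : E d) (r : ℝ) :
    hessBatch p N x xref r ≤ N ∧ (hessBatch p N x xref r : ℝ) ≤
      1 + 64 * p.L₂ ^ 2 * Real.log (4 * (d : ℝ) / p.ζ) / p.α ^ 2 *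
        (‖x - xref‖ ^ 2 / p.ε₁ ^ 2) := by
  have hd' : (1 : ℝ) ≤ d := by exact_mod_cast hd
  have harg : 1 ≤ 4 * (d : ℝ) / p.ζ := by
    rw [le_div_iff₀ hζ]; linarith
  have hlog := Real.log_nonneg harg
  have hR : p.ε₁ ^ 2 ≤ max (r ^ 2) (p.ε₁ ^ 2) := le_max_right _ _
  have hR0 : 0 < max (r ^ 2) (p.ε₁ ^ 2) := lt_of_lt_of_le (by positivity) hR
  unfold hessBatch
  refine ⟨batchSize_le hN (by positivity) (by positivity),
    (batchSize_le_one_add hN (by positivity) (by positivity)).trans ?_⟩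
  gcongr
  rw [div_mul_div_comm]
  refine (div_le_div_of_nonneg_left (by positivity) (by positivity)
    (mul_le_mul_of_nonneg_left hR (by positivity))).trans (le_of_eq ?_)
  congr 1
  ring

theorem iteration_outer_le (hd : 1 ≤ d) (hN : 1 ≤ N) {L₀ L₁ L₂ : ℝ≥0}
    (hf : StandingAssumption f L₀ L₁ L₂) (hL₁ : p.L₁ = L₁) (hL₂ : p.L₂ = L₂) {Δ ε : ℝ}
    (hΔ : objective f x₀ - (⨅ x, objective f x) ≤ Δ) (hε : 0 < p.ε₁) (hα : 0 < p.α)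
    (hβ : 0 < p.β) (hM : 0 ≤ p.M) (hζ : 0 < p.ζ) (hζ1 : p.ζ ≤ 1)
    (hγ : 0 < gammaConst p.L₂ p.M p.α p.β)
    (hτ₁ : ((p.L₂ + p.M) / 2 + 2 * p.β + 2 * p.α) * p.ε₁ ^ 2 ≤ ε)
    (hτ₂ : ((p.M + 2 * p.L₂) / 2 + 2 * p.α) * p.ε₁ ≤ Real.sqrt ε)
    {solve : E d → (E d →L[ℝ] E d) → E d} (hsolve : IsCubicSolver p.M solve)
    (hc₂ : c₂ = 64 * p.L₂ ^ 2 * Real.log (4 * (d : ℝ) / p.ζ) / p.α ^ 2) {B : ℝ}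
    (hB : B = totalCost N p.m c₂ (iterBound p.L₂ p.M p.α p.β Δ p.ε₁)) {σ : State d}
    (hσ : Invariant p f x₀ c₂ ε B k σ) :
    (iteration p f solve k σ).toOuterMeasure {σ | ¬ Invariant p f x₀ c₂ ε B (k + 1) σ} ≤
      ENNReal.ofReal p.ζ := by
  have hd' : (1 : ℝ) ≤ d := by exact_mod_cast hd
  have harg : 1 ≤ 4 * (d : ℝ) / p.ζ := by
    rw [le_div_iff₀ hζ]; linarith
  have hc : 0 ≤ c₂ := by
    have := Real.log_nonneg harg
    rw [hc₂]; positivity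
  cases σ with
  | done y cost =>
    have : (State.done y cost : State d) ∉ {σ | ¬ Invariant p f x₀ c₂ ε B (k + 1) σ} := by
      rw [Set.mem_ofPred_eq, not_not]; exact hσ
    simp only [iteration]
    rw [PMF.toOuterMeasure_pure_apply, if_neg this]
    exact zero_le
  | running x xref r cost =>
    obtain ⟨P, hE, hC⟩ := hσ
    have hR : 0 < max r p.ε₁ := lt_max_of_lt_right hε
    simp only [iteration]
    split_ifs with hk
    · rw [PMF.toOuterMeasure_pure_apply, if_neg]
      · exact zero_le
      · rw [Set.mem_ofPred_eq, not_not, hB]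
        refine invariant_advance hN hf hL₂ hΔ hε hα hβ hM hγ hc hτ₁ hτ₂ hsolve
          (hess_symm (contDiff_objective hf) x) ?_ ?_ hE (hC.reset hk hε hc _)
        · rw [sub_self, norm_zero]; positivity
        · rw [sub_self, norm_zero]; positivity
    · have h1 := gradEst_outer_le hN hf hL₁ hε hβ hζ hζ1 x xref hE.nonneg
      have h2 := hessEst_outer_le hd hN hf hL₂ hε hα hζ hζ1 x xref hE.nonneg
      obtain ⟨hn, hn'⟩ := hessBatch_le hd hN hε hα hζ hζ1 x xref r
      rw [← hc₂] at hn'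
      have e : p.ζ = p.ζ / 2 + p.ζ / 2 := by ring
      rw [e, ENNReal.ofReal_add (by positivity) (by positivity)]
      refine le_trans (bind_outer_le _ _ _ _ fun ξg _ hξg => ?_) (add_le_add_left h1 _)
      -- Once both samples are accurate, the invariant is preserved with certainty.
      refine le_trans (bind_outer_le _ _ _ _ (b := 0) fun ξH hsupp hξH => ?_)
        ((add_zero _).le.trans h2)
      rw [Set.mem_ofPred_eq, not_not] at hξg hξH
      rw [PMF.toOuterMeasure_pure_apply, if_neg]
      rw [Set.mem_ofPred_eq, not_not, hB]
      rw [mem_support_sampleSubset hn hsupp]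
      exact invariant_advance hN hf hL₂ hΔ hε hα hβ hM hγ hc hτ₁ hτ₂ hsolve
          (hessEst_symm hf x xref ξH) hξg hξH hE (hC.step hk hε hc _ hn')

theorem run_outer_le (hm : 1 ≤ p.m) (hd : 1 ≤ d) (hN : 1 ≤ N) {L₀ L₁ L₂ : ℝ≥0}
    (hf : StandingAssumption f L₀ L₁ L₂) (hL₁ : p.L₁ = L₁) (hL₂ : p.L₂ = L₂) {Δ ε : ℝ}
    (hΔ : objective f x₀ - (⨅ x, objective f x) ≤ Δ) (hε : 0 < p.ε₁) (hα : 0 < p.α)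
    (hβ : 0 < p.β) (hM : 0 ≤ p.M) (hζ : 0 < p.ζ) (hζ1 : p.ζ ≤ 1)
    (hγ : 0 < gammaConst p.L₂ p.M p.α p.β)
    (hτ₁ : ((p.L₂ + p.M) / 2 + 2 * p.β + 2 * p.α) * p.ε₁ ^ 2 ≤ ε)
    (hτ₂ : ((p.M + 2 * p.L₂) / 2 + 2 * p.α) * p.ε₁ ≤ Real.sqrt ε)
    {solve : E d → (E d →L[ℝ] E d) → E d} (hsolve : IsCubicSolver p.M solve)
    (hc₂ : c₂ = 64 * p.L₂ ^ 2 * Real.log (4 * (d : ℝ) / p.ζ) / p.α ^ 2) {B : ℝ}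
    (hB : B = totalCost N p.m c₂ (iterBound p.L₂ p.M p.α p.β Δ p.ε₁)) (n : ℕ) :
    (run p f solve x₀ n).toOuterMeasure {σ | ¬ Invariant p f x₀ c₂ ε B n σ} ≤
      ENNReal.ofReal (n * p.ζ) := by
  induction n with
  | zero =>
    simp only [run]
    rw [PMF.toOuterMeasure_pure_apply, if_neg]
    · exact zero_le
    · rw [Set.mem_ofPred_eq, not_not]
      refine ⟨0, ⟨hε.le, by simp, by simp⟩, costBound_zero hm⟩
  | succ n ih =>
    simp only [run]
    have e : ((n + 1 : ℕ) : ℝ) * p.ζ = n * p.ζ + p.ζ := by push_cast; ring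
    rw [e, ENNReal.ofReal_add (by positivity) hζ.le]
    refine le_trans (bind_outer_le _ _ _ _ fun σ _ hσ => ?_) (add_le_add_left ih _)
    rw [Set.mem_ofPred_eq, not_not] at hσ
    exact iteration_outer_le hd hN hf hL₁ hL₂ hΔ hε hα hβ hM hζ hζ1 hγ hτ₁ hτ₂ hsolve hc₂ hB hσ

theorem outer_ge_of_compl_le {α : Type*} (q : PMF α) {S T : Set α} {δ : ℝ} (hδ : 0 ≤ δ)
    (h : q.toOuterMeasure S ≤ ENNReal.ofReal δ) (hT : ∀ a, a ∉ S → a ∈ T) :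
    ENNReal.ofReal (1 - δ) ≤ q.toOuterMeasure T := by
  rw [ENNReal.ofReal_sub _ hδ, ENNReal.ofReal_one, tsub_le_iff_right]
  rw [← outer_univ q]
  refine le_trans (MeasureTheory.measure_mono (t := T ∪ S) fun a _ => ?_)
    ((MeasureTheory.measure_union_le _ _).trans (add_le_add_right h _))
  by_cases ha : a ∈ S
  · exact Or.inr ha
  · exact Or.inl (hT a ha)

end Probability

/-! ### Explicit constants in `N`, `ε` and `δ` -/

section Constants

theorem pos_of_gammaConst_pos {L₂ M α β : ℝ} (hL : 0 ≤ L₂) (hα : 0 < α) (hβ : 0 < β)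
    (hγ : 0 < gammaConst L₂ M α β) : 0 < M := by
  unfold gammaConst at hγ
  linarith

theorem tauConst_pos {L₂ M α β : ℝ} (hL : 0 ≤ L₂) (hM : 0 < M) (hα : 0 < α) (hβ : 0 < β) :
    0 < tauConst L₂ M α β :=
  lt_min (Real.rpow_pos_of_pos (by positivity) _) (by positivity)

theorem mul_tauConst_sq_le {L₂ M α β : ℝ} (hL : 0 ≤ L₂) (hM : 0 < M) (hα : 0 < α) (hβ : 0 < β) :
    ((L₂ + M) / 2 + 2 * β + 2 * α) * tauConst L₂ M α β ^ 2 ≤ 1 := by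
  have hT : 0 < (L₂ + M) / 2 + 2 * β + 2 * α := by positivity
  have h1 : tauConst L₂ M α β ^ 2 ≤ ((L₂ + M) / 2 + 2 * β + 2 * α)⁻¹ := by
    refine (pow_le_pow_left₀ (tauConst_pos hL hM hα hβ).le (min_le_left _ _) 2).trans (le_of_eq ?_)
    rw [← Real.rpow_natCast, ← Real.rpow_mul hT.le, ← Real.rpow_neg_one]
    norm_num
  calc _ ≤ ((L₂ + M) / 2 + 2 * β + 2 * α) * ((L₂ + M) / 2 + 2 * β + 2 * α)⁻¹ := by gcongr
    _ = 1 := mul_inv_cancel₀ hT.ne'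

theorem mul_tauConst_le {L₂ M α β : ℝ} (hL : 0 ≤ L₂) (hM : 0 < M) (hα : 0 < α) :
    ((M + 2 * L₂) / 2 + 2 * α) * tauConst L₂ M α β ≤ 1 := by
  have hT : 0 < (M + 2 * L₂) / 2 + 2 * α := by positivity
  calc _ ≤ ((M + 2 * L₂) / 2 + 2 * α) * ((M + 2 * L₂) / 2 + 2 * α)⁻¹ := by
        gcongr; exact min_le_right _ _
    _ = 1 := mul_inv_cancel₀ hT.ne'

theorem sqrt_pow_three {ε : ℝ} (hε : 0 ≤ ε) : Real.sqrt ε ^ 3 = ε ^ (3 / 2 : ℝ) := by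
  rw [Real.sqrt_eq_rpow, ← Real.rpow_natCast, ← Real.rpow_mul hε]
  norm_num

/-- The iteration bound is at most this constant times `ε^(-3/2)`. -/
noncomputable def iterConst (L₂ M α β Δ : ℝ) : ℝ :=
  |Δ| / (gammaConst L₂ M α β * tauConst L₂ M α β ^ 3) + (2 * β + α) / gammaConst L₂ M α β + 1

theorem one_le_iterConst {L₂ M α β : ℝ} (Δ : ℝ) (hL : 0 ≤ L₂) (hα : 0 < α) (hβ : 0 < β)
    (hγ : 0 < gammaConst L₂ M α β) : 1 ≤ iterConst L₂ M α β Δ := by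
  have hτ := tauConst_pos hL (pos_of_gammaConst_pos hL hα hβ hγ) hα hβ
  have : 0 ≤ |Δ| / (gammaConst L₂ M α β * tauConst L₂ M α β ^ 3) +
    (2 * β + α) / gammaConst L₂ M α β := by positivity
  unfold iterConst
  linarith

theorem iterBound_le {L₂ M α β Δ ε : ℝ} (hL : 0 ≤ L₂) (hα : 0 < α) (hβ : 0 < β)
    (hγ : 0 < gammaConst L₂ M α β) (hε : 0 < ε) (hε1 : ε ≤ 1) :
    (iterBound L₂ M α β Δ (tauConst L₂ M α β * Real.sqrt ε) : ℝ) ≤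
      iterConst L₂ M α β Δ * (1 / ε ^ (3 / 2 : ℝ)) := by
  have hτ := tauConst_pos hL (pos_of_gammaConst_pos hL hα hβ hγ) hα hβ
  have he : 0 < ε ^ (3 / 2 : ℝ) := Real.rpow_pos_of_pos hε _
  have he1 : 1 ≤ 1 / ε ^ (3 / 2 : ℝ) := by
    rw [le_div_iff₀ he, one_mul]
    exact Real.rpow_le_one hε.le hε1 (by norm_num)
  unfold iterBound iterConst
  rw [mul_pow, sqrt_pow_three hε.le]
  set y := ε ^ (3 / 2 : ℝ)
  set γ := gammaConst L₂ M α β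
  set τ := tauConst L₂ M α β
  have h1 : (Δ + (2 * β + α) * (τ ^ 3 * y)) / (γ * (τ ^ 3 * y)) ≤
      |Δ| / (γ * τ ^ 3) * (1 / y) + (2 * β + α) / γ * (1 / y) := by
    have : (Δ + (2 * β + α) * (τ ^ 3 * y)) / (γ * (τ ^ 3 * y)) =
      Δ / (γ * τ ^ 3) * (1 / y) + (2 * β + α) / γ * 1 := by field_simp
    rw [this]
    gcongr
    exact le_abs_self Δ
  have h0 : 0 ≤ |Δ| / (γ * τ ^ 3) * (1 / y) + (2 * β + α) / γ * (1 / y) := by positivity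
  have h2 : (⌊(Δ + (2 * β + α) * (τ ^ 3 * y)) / (γ * (τ ^ 3 * y))⌋₊ : ℝ) ≤
      |Δ| / (γ * τ ^ 3) * (1 / y) + (2 * β + α) / γ * (1 / y) :=
    (Nat.cast_le.2 (Nat.floor_le_floor h1)).trans (Nat.floor_le h0)
  push_cast
  linarith

theorem one_le_log_div {d ε δ : ℝ} (hd : 1 ≤ d) (hε : 0 < ε) (hε1 : ε ≤ 1) (hδ : 0 < δ)
    (hδ1 : δ < 1) : 1 ≤ Real.log (8 * d / (ε * δ)) := by
  have hx : 8 ≤ 8 * d / (ε * δ) := by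
    rw [le_div_iff₀ (by positivity)]
    have : ε * δ ≤ 1 := mul_le_one₀ hε1 hδ.le hδ1.le
    nlinarith
  rw [Real.le_log_iff_exp_le (by linarith)]
  linarith [Real.exp_one_lt_d9]

theorem log_batch_le {d ε δ K C₁ : ℝ} (hd : 1 ≤ d) (hε : 0 < ε) (hε1 : ε ≤ 1) (hδ : 0 < δ)
    (hδ1 : δ < 1) (hK : 1 ≤ K) (hC : 1 ≤ C₁) (hKC : K ≤ C₁ * (1 / ε ^ (3 / 2 : ℝ))) :
    Real.log (4 * d / (δ / (2 * K))) ≤ (Real.log C₁ + 2) * Real.log (8 * d / (ε * δ)) := by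
  have hΛ := one_le_log_div hd hε hε1 hδ hδ1
  have h2 : ε ^ 2 ≤ ε ^ (3 / 2 : ℝ) := by
    rw [← Real.rpow_natCast]
    exact Real.rpow_le_rpow_of_exponent_ge hε hε1 (by norm_num)
  have h3 : K ≤ C₁ * (1 / ε ^ 2) := hKC.trans (by gcongr)
  have h4 : 1 ≤ 8 * d / δ := by rw [le_div_iff₀ hδ]; linarith
  -- The power `ε^{-3/2}` is weakened to `ε^{-2}` so that everything fits into the square of `8d /
  -- (ε δ)`, whose logarithm is the one in the theorem.
  have h5 : 4 * d / (δ / (2 * K)) ≤ C₁ * (8 * d / (ε * δ)) ^ 2 := by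
    calc 4 * d / (δ / (2 * K)) = 8 * d / δ * K := by field_simp; ring
      _ ≤ (8 * d / δ) ^ 2 * (C₁ * (1 / ε ^ 2)) := by
        gcongr
        exact le_self_pow₀ h4 (by norm_num)
      _ = _ := by field_simp
  have hlogC := Real.log_nonneg hC
  calc Real.log (4 * d / (δ / (2 * K))) ≤ Real.log (C₁ * (8 * d / (ε * δ)) ^ 2) :=
        Real.log_le_log (by positivity) h5
    _ = Real.log C₁ + 2 * Real.log (8 * d / (ε * δ)) := by
        rw [Real.log_mul (by positivity) (by positivity), Real.log_pow]; norm_num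
    _ ≤ _ := by nlinarith

/-- The choice `m ≈ N^{1/3}` makes `N/m` and `m²` both of order `N^{2/3}`. In `3 + 16 c`, the `3`
collects `N K/m` and `K + 1`, and the `16` includes a `4` from `m ≤ 2 N^{1/3}`. -/
theorem totalCost_le {N : ℕ} (hN : 1 ≤ N) {c₂ K c Λ C₁ y : ℝ} (hK : 1 ≤ K)
    (hKC : K ≤ C₁ * y) (hΛ : 1 ≤ Λ) (hc : 0 ≤ c) (hc₂ : c₂ ≤ c * Λ) :
    totalCost N ⌈(N : ℝ) ^ (1 / 3 : ℝ)⌉₊ c₂ K ≤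
      N + C₁ * (3 + 16 * c) * (N : ℝ) ^ (2 / 3 : ℝ) * y * Λ := by
  have hN' : (1 : ℝ) ≤ N := by exact_mod_cast hN
  have hn1 : 1 ≤ (N : ℝ) ^ (1 / 3 : ℝ) := Real.one_le_rpow hN' (by norm_num)
  have e2 : (N : ℝ) ^ (2 / 3 : ℝ) = ((N : ℝ) ^ (1 / 3 : ℝ)) ^ 2 := by
    rw [← Real.rpow_natCast, ← Real.rpow_mul (by linarith)]; norm_num
  have e3 : (N : ℝ) = ((N : ℝ) ^ (1 / 3 : ℝ)) ^ 3 := by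
    rw [← Real.rpow_natCast, ← Real.rpow_mul (by linarith)]; norm_num
  have hm1 := Nat.le_ceil ((N : ℝ) ^ (1 / 3 : ℝ))
  have hm2 := (Nat.ceil_lt_add_one (a := (N : ℝ) ^ (1 / 3 : ℝ)) (by linarith)).le
  rw [e2]
  unfold totalCost
  set n := (N : ℝ) ^ (1 / 3 : ℝ)
  set m : ℝ := (⌈n⌉₊ : ℝ)
  have h1 : N * K / m ≤ n ^ 2 * K := by
    rw [div_le_iff₀ (by linarith), e3]
    have : 0 ≤ n ^ 2 * K := by positivity
    nlinarith
  have h2 : m ^ 2 ≤ 4 * n ^ 2 := by nlinarith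
  have h3 : 4 * c₂ * m ^ 2 * K ≤ 16 * c * Λ * n ^ 2 * K := by
    have a1 : c₂ * m ^ 2 ≤ (c * Λ) * (4 * n ^ 2) := by
      calc c₂ * m ^ 2 ≤ (c * Λ) * m ^ 2 := by gcongr
        _ ≤ _ := by gcongr
    nlinarith
  have h4 : K + 1 ≤ 2 * (n ^ 2 * K) := by
    have := le_mul_of_one_le_left (zero_le_one.trans hK) (one_le_pow₀ hn1 (n := 2))
    linarith
  have h5 : n ^ 2 * K ≤ n ^ 2 * K * Λ := le_mul_of_one_le_right (by positivity) hΛ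
  have h6 : n ^ 2 * K * Λ * (3 + 16 * c) ≤ n ^ 2 * (C₁ * y) * Λ * (3 + 16 * c) := by gcongr
  linarith

end Constants

end SVRC

/-! ### Assembly of the main theorem -/

theorem theorem6 (L₀ L₁ L₂ : ℝ≥0) (M α β Δ : ℝ) (hα : 0 < α) (hβ : 0 < β)
    (hγ : 0 < SVRC.gammaConst L₂ M α β) :
    ∃ C : ℝ, 0 < C ∧
      ∀ (d N : ℕ), 1 ≤ d → 1 ≤ N →
      ∀ (f : Fin N → SVRC.E d → ℝ) (x₀ : SVRC.E d)
        (solve : SVRC.E d → (SVRC.E d →L[ℝ] SVRC.E d) → SVRC.E d),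
        SVRC.StandingAssumption f L₀ L₁ L₂ →
        SVRC.objective f x₀ - (⨅ x, SVRC.objective f x) ≤ Δ →
        SVRC.IsCubicSolver M solve →
        ∀ ε δ : ℝ, 0 < ε → ε ≤ 1 → 0 < δ → δ < 1 →
          ∃ n : ℕ,
            ENNReal.ofReal (1 - δ) ≤
              (SVRC.run (SVRC.paramsFor L₁ L₂ M α β Δ N ε δ) f solve x₀ n).toOuterMeasure
                {σ | ∃ (y : SVRC.E d) (cost : ℕ), σ = SVRC.State.done y cost ∧
                  SVRC.IsApproxSOSP (SVRC.objective f) ε y ∧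
                  (cost : ℝ) ≤ N + C * (N : ℝ) ^ (2 / 3 : ℝ) / ε ^ (3 / 2 : ℝ)
                    * Real.log (8 * d / (ε * δ)) ∧
                  ((N : ℝ) ^ (1 / 3 : ℝ) ≤ ε ^ (-(3 / 2) : ℝ) →
                    (cost : ℝ) ≤ C * (N : ℝ) ^ (2 / 3 : ℝ) / ε ^ (3 / 2 : ℝ)
                      * Real.log (8 * d / (ε * δ)))} := by
  have hL : (0 : ℝ) ≤ L₂ := L₂.2
  have hM := SVRC.pos_of_gammaConst_pos hL hα hβ hγ
  have hτ := SVRC.tauConst_pos hL hM hα hβ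
  set C₁ := SVRC.iterConst L₂ M α β Δ with hC₁
  have hC1 : 1 ≤ C₁ := SVRC.one_le_iterConst Δ hL hα hβ hγ
  have hlogC := Real.log_nonneg hC1
  set c : ℝ := 64 * (L₂ : ℝ) ^ 2 / α ^ 2 * (Real.log C₁ + 2) with hc
  have hc0 : 0 ≤ c := by positivity
  -- The extra `1` absorbs the initial full Hessian: `N = N^{2/3} N^{1/3} ≤ N^{2/3} ε^{-3/2}` when
  -- `N` is small enough.
  refine ⟨C₁ * (3 + 16 * c) + 1, by positivity, ?_⟩
  intro d N hd hN f x₀ solve hf hΔ hsolve ε δ hε hε1 hδ hδ1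
  have hd' : (1 : ℝ) ≤ d := by exact_mod_cast hd
  have hN' : (1 : ℝ) ≤ N := by exact_mod_cast hN
  set K : ℕ := SVRC.iterBound L₂ M α β Δ (SVRC.tauConst L₂ M α β * Real.sqrt ε) with hK
  have hK1 : (1 : ℝ) ≤ K := by
    have : 1 ≤ K := Nat.le_add_left 1 _
    exact_mod_cast this
  have hKC : (K : ℝ) ≤ C₁ * (1 / ε ^ (3 / 2 : ℝ)) := SVRC.iterBound_le hL hα hβ hγ hε hε1
  have hsq := Real.sqrt_pos.2 hε
  have hss : Real.sqrt ε ^ 2 = ε := Real.sq_sqrt hε.le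
  set p := SVRC.paramsFor L₁ L₂ M α β Δ N ε δ with hp
  set Λ := Real.log (8 * d / (ε * δ)) with hΛdef
  have hΛ : 1 ≤ Λ := SVRC.one_le_log_div hd' hε hε1 hδ hδ1
  have hζ : p.ζ = δ / (2 * K) := rfl
  have hζ0 : 0 < p.ζ := by rw [hζ]; positivity
  have hζ1 : p.ζ ≤ 1 := by
    rw [hζ, div_le_one (by positivity)]; linarith
  have hm : 1 ≤ p.m := Nat.one_le_ceil_iff.2 (Real.rpow_pos_of_pos (by linarith) _)
  have hrun := SVRC.run_outer_le (p := p) (ε := ε) (x₀ := x₀) hm hd hN hf rfl rfl hΔ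
    (mul_pos hτ hsq) hα hβ hM.le hζ0 hζ1 hγ
    (by
      change ((L₂ + M) / 2 + 2 * β + 2 * α) * (SVRC.tauConst L₂ M α β * Real.sqrt ε) ^ 2 ≤ ε
      rw [mul_pow, hss, ← mul_assoc]
      exact mul_le_of_le_one_left hε.le (SVRC.mul_tauConst_sq_le hL hM hα hβ))
    (by
      change ((M + 2 * L₂) / 2 + 2 * α) * (SVRC.tauConst L₂ M α β * Real.sqrt ε) ≤ Real.sqrt ε
      rw [← mul_assoc]
      exact mul_le_of_le_one_left hsq.le (SVRC.mul_tauConst_le hL hM hα))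
    hsolve rfl rfl (K + 1)
  -- A running state satisfying the invariant has index at most `K`, so after `K + 1` iterations
  -- only stopped states remain. The failure probability is `(K + 1) δ / (2K) ≤ δ`, since `K ≥ 1`.
  refine ⟨K + 1, SVRC.outer_ge_of_compl_le _ hδ.le
    (hrun.trans (ENNReal.ofReal_le_ofReal ?_)) ?_⟩
  · rw [hζ, mul_div_assoc', div_le_iff₀ (by positivity)]
    push_cast
    nlinarith
  · intro σ hσ
    rw [Set.mem_ofPred_eq, not_not] at hσ
    cases σ with
    | running x xref r cost =>
      obtain ⟨P, hE, -⟩ := hσ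
      have := (hE.bounds hf.bddBelow hΔ (mul_pos hτ hsq) hα hβ hγ).1
      exact absurd this (Nat.not_succ_le_self K)
    | done y cost =>
      obtain ⟨hy, hcost⟩ := hσ
      have hlog := SVRC.log_batch_le hd' hε hε1 hδ hδ1 hK1 hC1 hKC
      have htot := SVRC.totalCost_le hN (c := c) (Λ := Λ)
        (c₂ := 64 * p.L₂ ^ 2 * Real.log (4 * (d : ℝ) / p.ζ) / p.α ^ 2) hK1 hKC hΛ hc0 (by
          change 64 * (L₂ : ℝ) ^ 2 * Real.log (4 * (d : ℝ) / (δ / (2 * K))) / α ^ 2 ≤ _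
          rw [hc, mul_div_right_comm, mul_assoc (64 * (L₂ : ℝ) ^ 2 / α ^ 2)]
          exact mul_le_mul_of_nonneg_left hlog (by positivity))
      have hcost' := hcost.trans htot
      have hy0 : 0 < ε ^ (3 / 2 : ℝ) := Real.rpow_pos_of_pos hε _
      have hX : 0 ≤ (N : ℝ) ^ (2 / 3 : ℝ) * (1 / ε ^ (3 / 2 : ℝ)) * Λ := by positivity
      have eX : (C₁ * (3 + 16 * c) + 1) * (N : ℝ) ^ (2 / 3 : ℝ) / ε ^ (3 / 2 : ℝ) * Λ =
          C₁ * (3 + 16 * c) * (N : ℝ) ^ (2 / 3 : ℝ) * (1 / ε ^ (3 / 2 : ℝ)) * Λ +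
            (N : ℝ) ^ (2 / 3 : ℝ) * (1 / ε ^ (3 / 2 : ℝ)) * Λ := by ring
      refine ⟨y, cost, rfl, hy, ?_, fun hNε => ?_⟩
      · rw [eX]; linarith
      · have hNN : (N : ℝ) ≤ (N : ℝ) ^ (2 / 3 : ℝ) * (1 / ε ^ (3 / 2 : ℝ)) * Λ := by
          rw [Real.rpow_neg hε.le, ← one_div] at hNε
          calc (N : ℝ) = (N : ℝ) ^ (2 / 3 : ℝ) * (N : ℝ) ^ (1 / 3 : ℝ) := by
                rw [← Real.rpow_add (by linarith)]; norm_num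
            _ ≤ (N : ℝ) ^ (2 / 3 : ℝ) * (1 / ε ^ (3 / 2 : ℝ)) := by gcongr
            _ ≤ _ := le_mul_of_one_le_right (by positivity) hΛ
        rw [eX]; linarith
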